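/- A matching of a finite set $S$ of points in the plane, each colored red or blue, is a set of pairwise disjoint axis-aligned closed rectangles, each of which covers exactly two points of $S$, these two being of the same color. For each integer $n\ge 1$ let $S_n$ be a set of $n$ independent uniform random points of $[0,1]^2$, each colored red or blue with probability $1/2$, all colors being independent of each other and of the points, and let $M(n)$ be the number of points of $S_n$ covered by a maximum matching of $S_n$. Let all the sets $S_n$, $n\ge 1$, be defined on one probability space, with an arbitrary dependence between different values of $n$. Then there exists a constant $\beta>0$, which does not depend on the probability space or on this dependence, such that $$\lim_{n\to\infty}\frac{M(n)}{n}=\lim_{n\to\infty}\frac{\mathbb{E}[M(n)]}{n}=\sup_{n\ge 1}\frac{\mathbb{E}[M(n)]}{n}\ge 0.83+\beta\quad\text{almost surely;}$$ in particular the limits exist. -/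

import Mathlib

open MeasureTheory ProbabilityTheory Filter Topology

namespace RectMatching

/-- A coloured point of the plane; the colour `true` is red, the colour `false` is blue. -/
abbrev ColoredPoint : Type := (ℝ × ℝ) × Bool

/-- A closed axis-aligned rectangle `[a.1, b.1] × [a.2, b.2]` in the plane.
(Segments and single points are allowed. Requiring positive side lengths would give the same
`maxCovered` below, as finitely many pairwise disjoint closed rectangles can be slightly enlarged
without meeting each other or further points of a finite set.) -/
def IsRectangle (r : Set (ℝ × ℝ)) : Prop :=
  ∃ a b : ℝ × ℝ, a.1 ≤ b.1 ∧ a.2 ≤ b.2 ∧ r = Set.Icc a.1 b.1 ×ˢ Set.Icc a.2 b.2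

/-- The indices of the points of the configuration `z` that lie in `r`. -/
def coveredBy {n : ℕ} (z : Fin n → ColoredPoint) (r : Set (ℝ × ℝ)) : Set (Fin n) :=
  {i | (z i).1 ∈ r}

/-- A matching of `z` with rectangles: a finite set of pairwise disjoint axis-aligned rectangles,
each of which covers exactly two points of `z`, these two being of the same colour. -/
structure IsMatching {n : ℕ} (z : Fin n → ColoredPoint) (R : Finset (Set (ℝ × ℝ))) : Prop where
  isRectangle : ∀ r ∈ R, IsRectangle r
  disjoint : ∀ r ∈ R, ∀ r' ∈ R, r ≠ r' → Disjoint r r'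
  covers_pair : ∀ r ∈ R, ∃ i j : Fin n, i ≠ j ∧ (z i).2 = (z j).2 ∧ coveredBy z r = {i, j}

/-- The number of points of `z` covered by the rectangles of `R`. -/
noncomputable def coveredCount {n : ℕ} (z : Fin n → ColoredPoint)
    (R : Finset (Set (ℝ × ℝ))) : ℕ :=
  (⋃ r ∈ R, coveredBy z r).ncard

/-- The number of points of `z` covered by a maximum matching. (The set is bounded by `n`, and
contains `0` because of the empty matching, so the supremum is a maximum.) -/
noncomputable def maxCovered {n : ℕ} (z : Fin n → ColoredPoint) : ℕ :=
  sSup {m | ∃ R : Finset (Set (ℝ × ℝ)), IsMatching z R ∧ m = coveredCount z R}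

/-- The law of one random coloured point: a uniform point of `[0, 1]²` together with an
independent fair colour. -/
noncomputable def coloredPointLaw : Measure ColoredPoint :=
  ((volume : Measure (ℝ × ℝ)).restrict (Set.Icc 0 1 ×ˢ Set.Icc 0 1)).prod
    (uniformOn (Set.univ : Set Bool))

/-- The law of `n` independent random coloured points. -/
noncomputable def configLaw (n : ℕ) : Measure (Fin n → ColoredPoint) :=
  Measure.pi fun _ => coloredPointLaw

/-- The expectation of `M(n)`. -/
noncomputable def expectedMax (n : ℕ) : ℝ :=
  ∫ z, (maxCovered z : ℝ) ∂(configLaw n)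

end RectMatching

/-! Every rectangle of a matching can be shrunk to the bounding box of its two points, so the number
of covered points depends only on the colours and on the orders of the two coordinates. Sorting by
abscissa therefore lets the abscissas be replaced by 0, 1, 2, …, while ordinates and colours stay
i.i.d.; this turns `expectedMax` into `gridMean`. Consecutive blocks of sorted points can be matched
separately, since vertical lines separate them. Hence `gridMean` is superadditive, and Fekete's
lemma gives the limit and its equality with the supremum.

For the lower bound, sweep the points from left to right and match each new point with the oldest
unmatched point of its colour that is known to be visible: the box of the two then avoids all other
points and all earlier rectangles. If k points have been seen, the rank of the next ordinate among
them and its colour take 2(k + 1) equally likely values, independently of the past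
(`seqLaw_cylinderSet`), so the expected gain over a bounded horizon is a finite sum. The sweep may
be stopped at any moment and started afresh on the remaining points, which are independent of the
past. A kernel computation (`le_value_first`) shows that a sweep over at most eight points, suitably
stopped, matches in expectation at least 0.831 times the expected number of points it consumes.
Induction on the number of points (`gridMean_ge`) yields `gridMean n ≥ 0.831 n - 7`, so the limit is
at least 0.831.

Finally, changing one point changes the maximum by at most 4 (`maxCovered_le_update`). Bounded
differences make deviations of order n exponentially unlikely, and Borel–Cantelli gives almost sure
convergence. Only the law of each single set enters there, so the dependence between different n is
irrelevant. -/

namespace RectMatching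


/-! ### Matchings as sets of index pairs, and their dependence on the coordinate orders. -/

/-- The smallest axis-aligned rectangle containing the points of `z` with indices `e.1`, `e.2`. -/
def box {ι : Type*} (z : ι → ColoredPoint) (e : ι × ι) : Set (ℝ × ℝ) :=
  Set.uIcc (z e.1).1.1 (z e.2).1.1 ×ˢ Set.uIcc (z e.1).1.2 (z e.2).1.2

/-- A matching of the points of `z` with indices in `s`, encoded by pairs of indices. -/
structure IsPairing {ι : Type*} (z : ι → ColoredPoint) (s : Set ι) (A : Finset (ι × ι)) :
    Prop where
  left_mem : ∀ e ∈ A, e.1 ∈ s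
  right_mem : ∀ e ∈ A, e.2 ∈ s
  ne : ∀ e ∈ A, e.1 ≠ e.2
  color : ∀ e ∈ A, (z e.1).2 = (z e.2).2
  covers : ∀ e ∈ A, ∀ i ∈ s, (z i).1 ∈ box z e → i = e.1 ∨ i = e.2
  disjoint : ∀ e ∈ A, ∀ e' ∈ A, e ≠ e' → Disjoint (box z e) (box z e')

theorem left_mem_box {ι : Type*} (z : ι → ColoredPoint) (e : ι × ι) : (z e.1).1 ∈ box z e :=
  ⟨Set.left_mem_uIcc, Set.left_mem_uIcc⟩

theorem right_mem_box {ι : Type*} (z : ι → ColoredPoint) (e : ι × ι) : (z e.2).1 ∈ box z e :=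
  ⟨Set.right_mem_uIcc, Set.right_mem_uIcc⟩

theorem isRectangle_box {ι : Type*} (z : ι → ColoredPoint) (e : ι × ι) : IsRectangle (box z e) :=
  ⟨(min (z e.1).1.1 (z e.2).1.1, min (z e.1).1.2 (z e.2).1.2),
    (max (z e.1).1.1 (z e.2).1.1, max (z e.1).1.2 (z e.2).1.2), by simp, by simp, rfl⟩

theorem disjoint_uIcc_iff (a b c d : ℝ) : Disjoint (Set.uIcc a b) (Set.uIcc c d) ↔
    ((a < c ∧ a < d) ∧ b < c ∧ b < d) ∨ ((c < a ∧ c < b) ∧ d < a ∧ d < b) := by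
  rw [Set.uIcc, Set.uIcc, Set.disjoint_iff_inter_eq_empty, Set.Icc_inter_Icc, Set.Icc_eq_empty_iff,
    not_le]
  simp only [sup_lt_iff, lt_inf_iff, inf_lt_iff, lt_sup_iff]
  constructor
  · intro h
    by_contra hc
    grind
  · grind

theorem disjoint_box_iff {ι : Type*} (z : ι → ColoredPoint) (e e' : ι × ι) :
    Disjoint (box z e) (box z e') ↔
      Disjoint (Set.uIcc (z e.1).1.1 (z e.2).1.1) (Set.uIcc (z e'.1).1.1 (z e'.2).1.1) ∨
      Disjoint (Set.uIcc (z e.1).1.2 (z e.2).1.2) (Set.uIcc (z e'.1).1.2 (z e'.2).1.2) :=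
  Set.disjoint_prod

/-- Membership in boxes and disjointness of boxes are Boolean combinations of coordinate
comparisons, so an embedding that preserves comparisons and colours transports pairings. -/
theorem IsPairing.map {ι κ : Type*} {z : ι → ColoredPoint} {z' : κ → ColoredPoint} {s : Set ι}
    {s' : Set κ} {A : Finset (ι × ι)} (h : IsPairing z s A) (f : ι ↪ κ)
    (hs : f '' s = s') (hc : ∀ i ∈ s, (z' (f i)).2 = (z i).2)
    (hx : ∀ i ∈ s, ∀ j ∈ s, (z' (f i)).1.1 ≤ (z' (f j)).1.1 ↔ (z i).1.1 ≤ (z j).1.1)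
    (hy : ∀ i ∈ s, ∀ j ∈ s, (z' (f i)).1.2 ≤ (z' (f j)).1.2 ↔ (z i).1.2 ≤ (z j).1.2) :
    IsPairing z' s' (A.map (f.prodMap f)) := by
  subst hs
  have hx' : ∀ i ∈ s, ∀ j ∈ s, (z' (f i)).1.1 < (z' (f j)).1.1 ↔ (z i).1.1 < (z j).1.1 :=
    fun i hi j hj => by simpa using (hx j hj i hi).not
  have hy' : ∀ i ∈ s, ∀ j ∈ s, (z' (f i)).1.2 < (z' (f j)).1.2 ↔ (z i).1.2 < (z j).1.2 :=
    fun i hi j hj => by simpa using (hy j hj i hi).not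
  constructor
  · simp only [Finset.mem_map, forall_exists_index, and_imp]
    rintro _ e he rfl
    exact ⟨_, h.left_mem e he, rfl⟩
  · simp only [Finset.mem_map, forall_exists_index, and_imp]
    rintro _ e he rfl
    exact ⟨_, h.right_mem e he, rfl⟩
  · simp only [Finset.mem_map, forall_exists_index, and_imp]
    rintro _ e he rfl
    simpa using h.ne e he
  · simp only [Finset.mem_map, forall_exists_index, and_imp]
    rintro _ e he rfl
    simp only [Function.Embedding.coe_prodMap, Prod.map_fst, Prod.map_snd]
    rw [hc _ (h.left_mem e he), hc _ (h.right_mem e he), h.color e he]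
  · simp only [Finset.mem_map, forall_exists_index, and_imp]
    rintro _ e he rfl _ ⟨i, hi, rfl⟩
    have h1 := h.left_mem e he
    have h2 := h.right_mem e he
    have := h.covers e he i hi
    simp only [Function.Embedding.coe_prodMap, Prod.map_fst, Prod.map_snd,
      EmbeddingLike.apply_eq_iff_eq]
    intro hm
    apply this
    simp only [box, Set.mem_prod, Set.mem_uIcc, Prod.map_fst, Prod.map_snd, hx _ h1 _ hi,
      hx _ hi _ h1, hx _ h2 _ hi, hx _ hi _ h2, hy _ h1 _ hi,
      hy _ hi _ h1, hy _ h2 _ hi, hy _ hi _ h2] at hm ⊢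
    exact hm
  · simp only [Finset.mem_map, forall_exists_index, and_imp]
    rintro _ e he rfl _ e' he' rfl hne
    have hne' : e ≠ e' := fun h => hne (by rw [h])
    have h1 := h.left_mem e he
    have h2 := h.right_mem e he
    have h3 := h.left_mem e' he'
    have h4 := h.right_mem e' he'
    have := h.disjoint e he e' he' hne'
    rw [disjoint_box_iff, disjoint_uIcc_iff, disjoint_uIcc_iff] at this ⊢
    simp only [Function.Embedding.coe_prodMap, Prod.map_fst, Prod.map_snd]
    rw [hx' _ h1 _ h3, hx' _ h1 _ h4, hx' _ h2 _ h3, hx' _ h2 _ h4,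
      hx' _ h3 _ h1, hx' _ h3 _ h2, hx' _ h4 _ h1, hx' _ h4 _ h2,
      hy' _ h1 _ h3, hy' _ h1 _ h4, hy' _ h2 _ h3, hy' _ h2 _ h4,
      hy' _ h3 _ h1, hy' _ h3 _ h2, hy' _ h4 _ h1, hy' _ h4 _ h2]
    exact this

/-- A vertical line separates the two groups, so no box of one group meets a point or a box of the
other. -/
theorem IsPairing.union {ι : Type*} [DecidableEq ι] {z : ι → ColoredPoint} {s t : Set ι}
    {A B : Finset (ι × ι)} (hA : IsPairing z s A) (hB : IsPairing z t B)
    (hst : ∀ i ∈ s, ∀ j ∈ t, (z i).1.1 < (z j).1.1) :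
    IsPairing z (s ∪ t) (A ∪ B) ∧ (A ∪ B).card = A.card + B.card := by
  have hdis : ∀ e ∈ A, ∀ e' ∈ B, Disjoint (box z e) (box z e') := by
    intro e he e' he'
    rw [disjoint_box_iff, disjoint_uIcc_iff]
    exact Or.inl <| Or.inl ⟨⟨hst _ (hA.left_mem e he) _ (hB.left_mem e' he'),
      hst _ (hA.left_mem e he) _ (hB.right_mem e' he')⟩,
      hst _ (hA.right_mem e he) _ (hB.left_mem e' he'),
      hst _ (hA.right_mem e he) _ (hB.right_mem e' he')⟩
  refine ⟨⟨?_, ?_, ?_, ?_, ?_, ?_⟩, ?_⟩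
  · intro e he
    rcases Finset.mem_union.1 he with he | he
    exacts [Or.inl (hA.left_mem e he), Or.inr (hB.left_mem e he)]
  · intro e he
    rcases Finset.mem_union.1 he with he | he
    exacts [Or.inl (hA.right_mem e he), Or.inr (hB.right_mem e he)]
  · intro e he
    rcases Finset.mem_union.1 he with he | he
    exacts [hA.ne e he, hB.ne e he]
  · intro e he
    rcases Finset.mem_union.1 he with he | he
    exacts [hA.color e he, hB.color e he]
  · intro e he i hi hm
    rcases Finset.mem_union.1 he with he | he
    · rcases hi with hi | hi
      · exact hA.covers e he i hi hm
      · have h1 := hst _ (hA.left_mem e he) _ hi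
        have h2 := hst _ (hA.right_mem e he) _ hi
        have := hm.1
        rw [Set.mem_uIcc] at this
        grind
    · rcases hi with hi | hi
      · have h1 := hst _ hi _ (hB.left_mem e he)
        have h2 := hst _ hi _ (hB.right_mem e he)
        have := hm.1
        rw [Set.mem_uIcc] at this
        grind
      · exact hB.covers e he i hi hm
  · intro e he e' he' hne
    rcases Finset.mem_union.1 he with he | he <;> rcases Finset.mem_union.1 he' with he' | he'
    exacts [hA.disjoint e he e' he' hne, hdis e he e' he', (hdis e' he' e he).symm,
      hB.disjoint e he e' he' hne]
  · apply Finset.card_union_of_disjoint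
    rw [Finset.disjoint_left]
    intro e he he'
    exact Set.disjoint_left.1 (hdis e he e he') (left_mem_box z e) (left_mem_box z e)

theorem coveredBy_box {n : ℕ} {z : Fin n → ColoredPoint} {A : Finset (Fin n × Fin n)}
    (h : IsPairing z Set.univ A) {e : Fin n × Fin n} (he : e ∈ A) :
    coveredBy z (box z e) = {e.1, e.2} := by
  ext i
  simp only [coveredBy, Set.mem_ofPred_eq, Set.mem_insert_iff, Set.mem_singleton_iff]
  constructor
  · exact h.covers e he i trivial
  · rintro (rfl | rfl)
    exacts [left_mem_box z e, right_mem_box z e]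

theorem bddAbove_coveredCount {n : ℕ} (z : Fin n → ColoredPoint) :
    BddAbove {m | ∃ R : Finset (Set (ℝ × ℝ)), IsMatching z R ∧ m = coveredCount z R} := by
  refine ⟨n, ?_⟩
  rintro m ⟨R, -, rfl⟩
  simpa [coveredCount] using Set.ncard_le_card (⋃ r ∈ R, coveredBy z r)

theorem two_mul_card_le_maxCovered {n : ℕ} {z : Fin n → ColoredPoint}
    {A : Finset (Fin n × Fin n)} (h : IsPairing z Set.univ A) : 2 * A.card ≤ maxCovered z := by
  classical
  refine le_csSup (bddAbove_coveredCount z) ⟨A.image (box z), ⟨?_, ?_, ?_⟩, ?_⟩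
  · simp only [Finset.mem_image, forall_exists_index, and_imp]
    rintro _ e he rfl
    exact isRectangle_box z e
  · simp only [Finset.mem_image, forall_exists_index, and_imp]
    rintro _ e he rfl _ e' he' rfl hne
    exact h.disjoint e he e' he' (fun h => hne (by rw [h]))
  · simp only [Finset.mem_image, forall_exists_index, and_imp]
    rintro _ e he rfl
    exact ⟨e.1, e.2, h.ne e he, h.color e he, coveredBy_box h he⟩
  · have : (⋃ r ∈ A.image (box z), coveredBy z r) = ↑(A.biUnion fun e => {e.1, e.2}) := by
      ext i
      simp only [Finset.mem_image, Set.iUnion_exists, Set.biUnion_and', Set.iUnion_iUnion_eq_right,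
        Set.mem_iUnion, Finset.coe_biUnion, exists_prop]
      refine exists_congr fun e => ⟨fun ⟨he, hi⟩ => ⟨he, ?_⟩, fun ⟨he, hi⟩ => ⟨he, ?_⟩⟩
      · rw [coveredBy_box h he] at hi
        simpa using hi
      · rw [coveredBy_box h he]
        simpa using hi
    rw [coveredCount, this, Set.ncard_coe_finset, Finset.card_biUnion, Finset.sum_congr rfl
      (fun e he => Finset.card_pair (h.ne e he)), Finset.sum_const, smul_eq_mul, mul_comm]
    intro e he e' he' hne
    have hd := h.disjoint e he e' he' hne
    rw [Function.onFun, Finset.disjoint_left]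
    intro i hi hi'
    have h1 : (z i).1 ∈ box z e := by
      have : i ∈ coveredBy z (box z e) := by rw [coveredBy_box h he]; simpa using hi
      exact this
    have h2 : (z i).1 ∈ box z e' := by
      have : i ∈ coveredBy z (box z e') := by rw [coveredBy_box h he']; simpa using hi'
      exact this
    exact Set.disjoint_left.1 hd h1 h2

/-- A rectangle contains the bounding box of its two points; shrinking to that box preserves
disjointness and the covered pair. Conversely the boxes of a pairing form a matching, by
`two_mul_card_le_maxCovered`. -/
theorem exists_isPairing_eq {n : ℕ} (z : Fin n → ColoredPoint) :
    ∃ A, IsPairing z Set.univ A ∧ maxCovered z = 2 * A.card := by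
  classical
  have hmem : maxCovered z ∈
      {m | ∃ R : Finset (Set (ℝ × ℝ)), IsMatching z R ∧ m = coveredCount z R} := by
    refine Nat.sSup_mem ⟨0, ∅, ⟨by simp, by simp, by simp⟩, by simp [coveredCount]⟩
      (bddAbove_coveredCount z)
  obtain ⟨R, hR, hm⟩ := hmem
  have hch : ∀ r : R, ∃ e : Fin n × Fin n, e.1 ≠ e.2 ∧ (z e.1).2 = (z e.2).2 ∧
      coveredBy z r = {e.1, e.2} := fun r => by
    obtain ⟨i, j, h⟩ := hR.covers_pair r r.2
    exact ⟨(i, j), h⟩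
  choose f hne hcol hcov using hch
  have hsub : ∀ r : R, box z (f r) ⊆ r := by
    intro r
    have h1 : (f r).1 ∈ coveredBy z r := by rw [hcov]; simp
    have h2 : (f r).2 ∈ coveredBy z r := by rw [hcov]; simp
    obtain ⟨a, b, -, -, hab⟩ := hR.isRectangle r r.2
    simp only [coveredBy, Set.mem_ofPred_eq] at h1 h2
    rw [hab] at h1 h2 ⊢
    exact Set.prod_mono (Set.uIcc_subset_Icc h1.1 h2.1) (Set.uIcc_subset_Icc h1.2 h2.2)
  have hdis : ∀ r r' : R, r ≠ r' → Disjoint (box z (f r)) (box z (f r')) := fun r r' h =>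
    (hR.disjoint r r.2 r' r'.2 (fun h' => h (Subtype.ext h'))).mono (hsub r) (hsub r')
  have hinj : Function.Injective f := by
    intro r r' h
    by_contra hne
    exact Set.disjoint_left.1 (hdis r r' hne) (left_mem_box z _) (h ▸ left_mem_box z _)
  have hA : IsPairing z Set.univ (Finset.univ.map ⟨f, hinj⟩) := by
    constructor
    · simp
    · simp
    · simp only [Finset.mem_map, Finset.mem_univ, Function.Embedding.coeFn_mk, true_and,
        forall_exists_index, forall_apply_eq_imp_iff]
      exact hne
    · simp only [Finset.mem_map, Finset.mem_univ, Function.Embedding.coeFn_mk, true_and,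
        forall_exists_index, forall_apply_eq_imp_iff]
      exact hcol
    · simp only [Finset.mem_map, Finset.mem_univ, Function.Embedding.coeFn_mk, true_and,
        forall_exists_index, forall_apply_eq_imp_iff]
      intro r i _ hi
      have : i ∈ coveredBy z r := hsub r hi
      rwa [hcov] at this
    · simp only [Finset.mem_map, Finset.mem_univ, Function.Embedding.coeFn_mk, true_and,
        forall_exists_index, forall_apply_eq_imp_iff]
      intro r r' h
      exact hdis r r' (fun h' => h (by rw [h']))
  refine ⟨_, hA, le_antisymm ?_ (two_mul_card_le_maxCovered hA)⟩
  rw [hm, coveredCount, Finset.card_map, Finset.card_univ, Fintype.card_coe]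
  have hU : (⋃ r ∈ R, coveredBy z r) = ↑(Finset.univ.biUnion fun r : R => {(f r).1, (f r).2}) := by
    ext i
    simp only [Set.mem_iUnion, Finset.coe_biUnion, Finset.coe_univ, Set.mem_univ,
      Set.iUnion_true, exists_prop]
    constructor
    · rintro ⟨r, hr, hi⟩
      refine ⟨⟨r, hr⟩, ?_⟩
      rw [hcov ⟨r, hr⟩] at hi
      simpa using hi
    · rintro ⟨r, hi⟩
      refine ⟨r, r.2, ?_⟩
      rw [hcov r]
      simpa using hi
  rw [hU, Set.ncard_coe_finset]
  calc _ ≤ ∑ r : R, ({(f r).1, (f r).2} : Finset (Fin n)).card := Finset.card_biUnion_le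
    _ ≤ ∑ r : R, 2 := Finset.sum_le_sum fun r _ => Finset.card_le_two
    _ = _ := by simp [mul_comm]

theorem maxCovered_le {n : ℕ} (z : Fin n → ColoredPoint) : maxCovered z ≤ n := by
  refine csSup_le' ?_
  rintro m ⟨R, -, rfl⟩
  simpa [coveredCount] using Set.ncard_le_card (⋃ r ∈ R, coveredBy z r)

theorem maxCovered_le_of_order {n : ℕ} {z z' : Fin n → ColoredPoint} (σ : Equiv.Perm (Fin n))
    (hc : ∀ i, (z' (σ i)).2 = (z i).2)
    (hx : ∀ i j, (z' (σ i)).1.1 ≤ (z' (σ j)).1.1 ↔ (z i).1.1 ≤ (z j).1.1)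
    (hy : ∀ i j, (z' (σ i)).1.2 ≤ (z' (σ j)).1.2 ↔ (z i).1.2 ≤ (z j).1.2) :
    maxCovered z ≤ maxCovered z' := by
  obtain ⟨A, hA, hm⟩ := exists_isPairing_eq z
  have := two_mul_card_le_maxCovered (hA.map (z' := z') (s' := Set.univ) σ.toEmbedding
    (by simp) (fun i _ => hc i) (fun i _ j _ => hx i j) fun i _ j _ => hy i j)
  rw [Finset.card_map] at this
  omega

theorem maxCovered_eq_of_order {n : ℕ} {z z' : Fin n → ColoredPoint} (σ : Equiv.Perm (Fin n))
    (hc : ∀ i, (z' (σ i)).2 = (z i).2)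
    (hx : ∀ i j, (z' (σ i)).1.1 ≤ (z' (σ j)).1.1 ↔ (z i).1.1 ≤ (z j).1.1)
    (hy : ∀ i j, (z' (σ i)).1.2 ≤ (z' (σ j)).1.2 ↔ (z i).1.2 ≤ (z j).1.2) :
    maxCovered z = maxCovered z' := by
  refine le_antisymm (maxCovered_le_of_order σ hc hx hy) (maxCovered_le_of_order σ.symm ?_ ?_ ?_)
  · intro i
    simpa using (hc (σ.symm i)).symm
  · intro i j
    simpa using (hx (σ.symm i) (σ.symm j)).symm
  · intro i j
    simpa using (hy (σ.symm i) (σ.symm j)).symm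

/-- By disjointness at most one box contains the old position of the point `k` and at most one its
new position. Dropping these two boxes leaves a valid pairing and loses at most four points. -/
theorem maxCovered_le_update {n : ℕ} {z z' : Fin n → ColoredPoint} (k : Fin n)
    (h : ∀ i, i ≠ k → z' i = z i) : maxCovered z ≤ maxCovered z' + 4 := by
  classical
  obtain ⟨A, hA, hm⟩ := exists_isPairing_eq z
  let B := A.filter fun e => e.1 ≠ k ∧ e.2 ≠ k ∧ (z' k).1 ∉ box z e
  have hB1 : ∀ e ∈ B, z' e.1 = z e.1 := fun e he => h _ (Finset.mem_filter.1 he).2.1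
  have hB2 : ∀ e ∈ B, z' e.2 = z e.2 := fun e he => h _ (Finset.mem_filter.1 he).2.2.1
  have hbox : ∀ e ∈ B, box z' e = box z e := fun e he => by
    rw [box, box, hB1 e he, hB2 e he]
  have hBA : ∀ e ∈ B, e ∈ A := fun e he => (Finset.mem_filter.1 he).1
  have hB : IsPairing z' Set.univ B := by
    refine ⟨fun _ _ => trivial, fun _ _ => trivial, fun e he => hA.ne e (hBA e he), ?_, ?_, ?_⟩
    · intro e he
      rw [hB1 e he, hB2 e he, hA.color e (hBA e he)]
    · intro e he i _ hi
      rw [hbox e he] at hi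
      rcases eq_or_ne i k with rfl | hik
      · exact absurd hi (Finset.mem_filter.1 he).2.2.2
      · rw [h i hik] at hi
        exact hA.covers e (hBA e he) i trivial hi
    · intro e he e' he' hne
      rw [hbox e he, hbox e' he']
      exact hA.disjoint e (hBA e he) e' (hBA e' he') hne
  have hone : ∀ p, (A.filter fun e => p ∈ box z e).card ≤ 1 := by
    intro p
    rw [Finset.card_le_one]
    intro e he e' he'
    simp only [Finset.mem_filter] at he he'
    by_contra hne
    exact Set.disjoint_left.1 (hA.disjoint e he.1 e' he'.1 hne) he.2 he'.2
  have hcard : A.card ≤ B.card + 2 := by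
    have hsub : A ⊆ B ∪ ((A.filter fun e => (z k).1 ∈ box z e) ∪
        A.filter fun e => (z' k).1 ∈ box z e) := by
      intro e he
      simp only [B, Finset.mem_union, Finset.mem_filter, he, true_and]
      by_cases h1 : e.1 = k
      · exact Or.inr (Or.inl (h1 ▸ left_mem_box z e))
      by_cases h2 : e.2 = k
      · exact Or.inr (Or.inl (h2 ▸ right_mem_box z e))
      by_cases h3 : (z' k).1 ∈ box z e
      · exact Or.inr (Or.inr h3)
      · exact Or.inl ⟨h1, h2, h3⟩
    have h1 := Finset.card_le_card hsub
    have h2 := Finset.card_union_le B ((A.filter fun e => (z k).1 ∈ box z e) ∪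
        A.filter fun e => (z' k).1 ∈ box z e)
    have h3 := Finset.card_union_le (A.filter fun e => (z k).1 ∈ box z e)
        (A.filter fun e => (z' k).1 ∈ box z e)
    have h4 := hone (z k).1
    have h5 := hone (z' k).1
    omega
  have := two_mul_card_le_maxCovered hB
  omega

/-! ### Sorted configurations, windows and superadditivity. -/

/-- The configuration in the plane with abscissas `0, 1, 2, …` and the given ordinates and
colours. -/
def graphPoint (w : ℕ → ℝ × Bool) (i : ℕ) : ColoredPoint := (((i : ℝ), (w i).1), (w i).2)

/-- The number of covered points in a maximum matching of the points of `graphPoint w` with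
indices in `[a, a + n)`. -/
noncomputable def windowMax (w : ℕ → ℝ × Bool) (a n : ℕ) : ℕ :=
  maxCovered fun i : Fin n => graphPoint w (a + i)

/-- The embedding of `Fin n` onto `[a, a + n)`. -/
def windowEmb (a n : ℕ) : Fin n ↪ ℕ := ⟨fun i => a + (i : ℕ), fun i j h => by
  have : a + (i : ℕ) = a + (j : ℕ) := h
  exact Fin.ext (by omega)⟩

theorem windowEmb_apply (a n : ℕ) (i : Fin n) : windowEmb a n i = a + i := rfl

theorem image_windowEmb (a n : ℕ) : windowEmb a n '' Set.univ = Set.Ico a (a + n) := by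
  ext k
  simp only [Set.image_univ, Set.mem_range, windowEmb_apply, Set.mem_Ico]
  constructor
  · rintro ⟨i, rfl⟩
    omega
  · intro hk
    exact ⟨⟨k - a, by omega⟩, by simp only; omega⟩

theorem two_mul_card_le_windowMax {w : ℕ → ℝ × Bool} {a n : ℕ} {A : Finset (ℕ × ℕ)}
    (h : IsPairing (graphPoint w) (Set.Ico a (a + n)) A) : 2 * A.card ≤ windowMax w a n := by
  obtain ⟨B, -, rfl⟩ : ∃ B ⊆ Finset.univ, A = B.map ((windowEmb a n).prodMap (windowEmb a n)) := by
    rw [← Finset.subset_map_iff]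
    intro e he
    have h1 := h.left_mem e he
    have h2 := h.right_mem e he
    rw [← image_windowEmb] at h1 h2
    obtain ⟨i, -, hi⟩ := h1
    obtain ⟨j, -, hj⟩ := h2
    exact Finset.mem_map.2 ⟨(i, j), Finset.mem_univ _, Prod.ext hi hj⟩
  have hmem : ∀ e ∈ B, ((windowEmb a n).prodMap (windowEmb a n)) e ∈
      B.map ((windowEmb a n).prodMap (windowEmb a n)) := fun e he => Finset.mem_map_of_mem _ he
  rw [Finset.card_map]
  refine two_mul_card_le_maxCovered ⟨fun _ _ => trivial, fun _ _ => trivial, fun e he heq => ?_,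
    fun e he => h.color _ (hmem e he), fun e he i _ hi => ?_, fun e he e' he' hne => ?_⟩
  · exact h.ne _ (hmem e he) (congrArg (windowEmb a n) heq)
  · have hi' : windowEmb a n i ∈ Set.Ico a (a + n) := image_windowEmb a n ▸ ⟨i, trivial, rfl⟩
    exact (h.covers _ (hmem e he) _ hi' hi).imp (fun h => (windowEmb a n).injective h)
      fun h => (windowEmb a n).injective h
  · have hne' : ((windowEmb a n).prodMap (windowEmb a n)) e ≠
        ((windowEmb a n).prodMap (windowEmb a n)) e' := fun heq =>
      hne (((windowEmb a n).prodMap (windowEmb a n)).injective heq)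
    have hd := h.disjoint _ (hmem e he) _ (hmem e' he') hne'
    exact hd

theorem exists_isPairing_windowMax (w : ℕ → ℝ × Bool) (a n : ℕ) :
    ∃ A, IsPairing (graphPoint w) (Set.Ico a (a + n)) A ∧ windowMax w a n = 2 * A.card := by
  obtain ⟨A, hA, hm⟩ := exists_isPairing_eq fun i : Fin n => graphPoint w (a + i)
  refine ⟨_, hA.map (z' := graphPoint w) (windowEmb a n) (image_windowEmb a n) (fun i _ => rfl)
    (fun i _ j _ => Iff.rfl) (fun i _ j _ => Iff.rfl), ?_⟩
  rw [Finset.card_map]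
  exact hm

/-- This is what allows the sweep to stop after `k` points: its rectangles stay to the left of the
next window, which can be matched optimally on its own. -/
theorem two_mul_card_add_windowMax_le {w : ℕ → ℝ × Bool} {k n : ℕ} {A : Finset (ℕ × ℕ)}
    (h : IsPairing (graphPoint w) (Set.Iio k) A) :
    2 * A.card + windowMax w k n ≤ windowMax w 0 (k + n) := by
  obtain ⟨B, hB, hm⟩ := exists_isPairing_windowMax w k n
  obtain ⟨hU, hc⟩ := h.union hB fun i hi j hj => by
    simp only [Set.mem_Iio, Set.mem_Ico] at hi hj
    simp only [graphPoint, Nat.cast_lt]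
    omega
  have hset : Set.Iio k ∪ Set.Ico k (k + n) = Set.Ico 0 (0 + (k + n)) := by
    ext i
    simp only [Set.mem_union, Set.mem_Iio, Set.mem_Ico]
    omega
  rw [hset] at hU
  have := two_mul_card_le_windowMax hU
  omega

theorem windowMax_add_windowMax_le (w : ℕ → ℝ × Bool) (m n : ℕ) :
    windowMax w 0 m + windowMax w m n ≤ windowMax w 0 (m + n) := by
  obtain ⟨A, hA, hm⟩ := exists_isPairing_windowMax w 0 m
  have hset : Set.Ico 0 (0 + m) = Set.Iio m := by ext; simp
  rw [hset] at hA
  rw [hm]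
  exact two_mul_card_add_windowMax_le hA


/-! ### The greedy sweep as a computation on lists of ranks. -/

/-- An unmatched point of the greedy sweep: its rank among the ordinates seen so far, its colour,
and the first and the last of the gaps between these ordinates in which a new point sees it. -/
structure Pending where
  pos : ℕ
  col : Bool
  lo : ℕ
  hi : ℕ

/-- `f n`, arranged so that `n` is evaluated before `f` is applied. -/
def forceNat {α : Type} (n : ℕ) (f : ℕ → α) : α :=
  Nat.rec (f 0) (fun m _ => f (m + 1)) n

/-- `f b`, arranged so that `b` is evaluated before `f` is applied. -/
def forceBool {α : Type} (b : Bool) (f : Bool → α) : α :=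
  Bool.rec (f false) (f true) b

/-- Pass to `k` the pending points that survive the arrival of a point in the gap `g`, when the
ranks from `a` to `b` become an obstacle. -/
def block {α : Type} (g a b : ℕ) (s : List Pending) : (List Pending → α) → α :=
  List.rec (fun k => k []) (fun q _ ih k => ih fun t =>
    forceNat (bif g.ble q.pos then q.pos + 1 else q.pos) fun p =>
    forceNat (bif g.blt q.lo then q.lo + 1 else q.lo) fun l =>
    forceNat (bif g.ble q.hi then q.hi + 1 else q.hi) fun h =>
    forceBool q.col fun c =>
      bif p.blt a then forceNat (bif a.ble h then a else h) fun h => k (⟨p, c, l, h⟩ :: t)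
      else bif b.blt p then forceNat (bif l.ble b then b + 1 else l) fun l => k (⟨p, c, l, h⟩ :: t)
      else k t) s

/-- The rank of the oldest pending point that a new point of colour `c` in the gap `g` can be
matched with; lists of pending points start with the newest one. -/
def partner (g : ℕ) (c : Bool) : List Pending → Option ℕ
  | [] => none
  | q :: s =>
    match partner g c s with
    | some p => some p
    | none => bif (bif c then q.col else !q.col) && q.lo.ble g && g.ble q.hi then some q.pos
        else none

/-- `∑ g ≤ n, f g`. -/
def sumTo (f : ℕ → ℕ) : ℕ → ℕ
  | 0 => f 0
  | g + 1 => sumTo f g + f (g + 1)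

/-- The number of ways in which `d` coloured points can join `k` points. -/
def units : ℕ → ℕ → ℕ
  | 0, _ => 1
  | d + 1, k => 2 * (k + 1) * units d (k + 1)

/-- Add `x` to a list of pending points, forgetting all but two points if `e` holds. -/
def addPending {α : Type} (e : Bool) (k : List Pending → α) (x : Pending) : List Pending → α
  | [] => k [x]
  | q :: t => bif e then k [x, q] else k (x :: q :: t)

/-- The reward for a new point of colour `c` in the gap `g`, `2000 * u` for a match, plus the value
`v` of the new list of pending points. -/
def gain (e : Bool) (u g : ℕ) (c : Bool) (s : List Pending) (k : ℕ)
    (v : List Pending → ℕ) : ℕ :=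
  match partner g c s with
  | some p => 2000 * u +
      forceNat (bif g.ble p then g else p) fun a =>
      forceNat (bif g.ble p then p + 1 else g) fun b => block g a b s v
  | none => block g g g s (addPending e v ⟨g, c, 0, k⟩)

/-- The reward of a match if a new point of colour `c` in the gap `g` can be matched. -/
def lastGain (g : ℕ) (c : Bool) (s : List Pending) : ℕ :=
  match partner g c s with
  | some _ => 2000
  | none => 0

/-- A lower bound for `1000 * units (d + 1) k` times the expected excess, over `0.831` for each
arriving point, of the number of points that the sweep matches with at most `d + 1` further points,
when it has seen `k` points and the pending ones are `s`. -/
def value : ℕ → ℕ → List Pending → ℕ :=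
  -- The truncated subtraction is the stopping rule: a negative expected excess is replaced by 0,
  -- which stopping at once achieves. The factors are 2000 = 1000 · 2 for the two points of a match
  -- and 831 = 1000 · 0.831 for each arrival.
  Nat.rec (fun k s => sumTo (fun g => lastGain g true s + lastGain g false s) k -
      831 * units 1 k) fun d ih k s =>
    match s with
    -- With nothing pending the sweep stops here, which achieves excess 0.
    | [] => 0
    | _ :: _ => forceNat (k + 1) fun k' =>
      -- Close to the horizon, when an unmatched point is added, only it and the newest surviving
      -- one are kept. This shortens the computation and can only weaken the bound.
      sumTo (fun g => gain (d.ble 2) (units (d + 1) k') g true s k' (ih k') +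
        gain (d.ble 2) (units (d + 1) k') g false s k' (ih k')) k - 831 * units (d + 2) k

theorem forceNat_eq {α : Type} (n : ℕ) (f : ℕ → α) : forceNat n f = f n := by
  cases n <;> rfl

theorem forceBool_eq {α : Type} (b : Bool) (f : Bool → α) : forceBool b f = f b := by
  cases b <;> rfl

/-- The effect on one pending point of a point in the gap `g`, when the ranks from `a` to `b` become
an obstacle. -/
def Pending.obstruct (g a b : ℕ) (q : Pending) : Option Pending :=
  let p := if g ≤ q.pos then q.pos + 1 else q.pos
  -- A new point in the lowest or the highest visible gap splits it into two visible gaps; hence the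
  -- strict comparison for `lo` and the weak one for `hi`. The obstacle then cuts the interval.
  let l := if g < q.lo then q.lo + 1 else q.lo
  let h := if g ≤ q.hi then q.hi + 1 else q.hi
  if p < a then some ⟨p, q.col, l, min a h⟩
  else if b < p then some ⟨p, q.col, max l (b + 1), h⟩ else none

theorem block_eq {α : Type} (g a b : ℕ) (s : List Pending) (k : List Pending → α) :
    block g a b s k = k (s.filterMap (Pending.obstruct g a b)) := by
  induction s generalizing k with
  | nil => rfl
  | cons q s ih =>
    have : block g a b (q :: s) k = block g a b s fun t =>
      forceNat (bif g.ble q.pos then q.pos + 1 else q.pos) fun p =>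
      forceNat (bif g.blt q.lo then q.lo + 1 else q.lo) fun l =>
      forceNat (bif g.ble q.hi then q.hi + 1 else q.hi) fun h =>
      forceBool q.col fun c =>
        bif p.blt a then forceNat (bif a.ble h then a else h) fun h => k (⟨p, c, l, h⟩ :: t)
        else bif b.blt p then forceNat (bif l.ble b then b + 1 else l) fun l =>
          k (⟨p, c, l, h⟩ :: t)
        else k t := rfl
    rw [this, ih, List.filterMap_cons]
    simp only [forceNat_eq, forceBool_eq, Pending.obstruct, Bool.cond_eq_ite, Nat.ble_eq,
      Nat.blt_eq]
    generalize (if g ≤ q.pos then q.pos + 1 else q.pos) = p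
    generalize (if g < q.lo then q.lo + 1 else q.lo) = l
    generalize (if g ≤ q.hi then q.hi + 1 else q.hi) = h
    have h1 : (if a ≤ h then a else h) = min a h := rfl
    have h2 : (if l ≤ b then b + 1 else l) = max l (b + 1) := by
      split_ifs <;> omega
    rw [h1, h2]
    split_ifs <;> rfl

theorem partner_eq_some {g p : ℕ} {c : Bool} {s : List Pending} (h : partner g c s = some p) :
    ∃ q ∈ s, q.pos = p ∧ q.col = c ∧ q.lo ≤ g ∧ g ≤ q.hi := by
  induction s with
  | nil => simp [partner] at h
  | cons q s ih =>
    rw [partner] at h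
    cases hp : partner g c s with
    | some p' =>
      rw [hp] at h
      obtain ⟨r, hr, h'⟩ := ih (hp.trans h)
      exact ⟨r, List.mem_cons_of_mem _ hr, h'⟩
    | none =>
      rw [hp] at h
      simp only [Bool.cond_eq_ite] at h
      split_ifs at h with hq hc
      · simp_all
      · simp_all

theorem sumTo_eq (f : ℕ → ℕ) (n : ℕ) : sumTo f n = ∑ g ∈ Finset.range (n + 1), f g := by
  induction n with
  | zero => simp [sumTo]
  | succ n ih => rw [sumTo, ih, ← Finset.sum_range_succ]

/-! ### Ranks, and the geometric correctness of the sweep. -/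

/-- The number of ordinates below the `j`-th one among the first `k`. -/
noncomputable def rank (w : ℕ → ℝ × Bool) (k j : ℕ) : ℕ :=
  ((Finset.range k).filter fun l => (w l).1 < (w j).1).card

theorem rank_succ (w : ℕ → ℝ × Bool) (k j : ℕ) :
    rank w (k + 1) j = rank w k j + if (w k).1 < (w j).1 then 1 else 0 := by
  rw [rank, Finset.range_add_one, Finset.filter_insert]
  split_ifs
  · rw [Finset.card_insert_of_notMem (by simp), rank]
  · rfl

theorem rank_succ_self (w : ℕ → ℝ × Bool) (k : ℕ) : rank w (k + 1) k = rank w k k := by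
  simp [rank_succ]

theorem rank_le (w : ℕ → ℝ × Bool) (k j : ℕ) : rank w k j ≤ k := by
  simpa [rank] using Finset.card_filter_le (Finset.range k) fun l => (w l).1 < (w j).1

theorem rank_lt_of_lt {w : ℕ → ℝ × Bool} {k i j : ℕ} (hi : i < k) (h : (w i).1 < (w j).1) :
    rank w k i < rank w k j := by
  apply Finset.card_lt_card
  rw [Finset.ssubset_iff_of_subset]
  · exact ⟨i, by simp [hi, h], by simp⟩
  · intro l hl
    simp only [Finset.mem_filter] at hl ⊢
    exact ⟨hl.1, hl.2.trans h⟩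

theorem rank_le_of_le {w : ℕ → ℝ × Bool} {k i j : ℕ} (h : (w i).1 ≤ (w j).1) :
    rank w k i ≤ rank w k j := by
  apply Finset.card_le_card
  intro l hl
  simp only [Finset.mem_filter] at hl ⊢
  exact ⟨hl.1, hl.2.trans_le h⟩

theorem lt_iff_rank_lt {w : ℕ → ℝ × Bool} {k i j : ℕ} (hi : i < k) :
    (w i).1 < (w j).1 ↔ rank w k i < rank w k j := by
  refine ⟨rank_lt_of_lt hi, fun h => ?_⟩
  by_contra hc
  exact absurd (rank_le_of_le (k := k) (not_lt.1 hc)) (by omega)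

theorem le_iff_rank_le {w : ℕ → ℝ × Bool} {k i j : ℕ} (hj : j < k) :
    (w i).1 ≤ (w j).1 ↔ rank w k i ≤ rank w k j := by
  rw [← not_lt, lt_iff_rank_lt hj, not_lt]

theorem rank_succ_eq {w : ℕ → ℝ × Bool} {k j : ℕ} (hj : j < k) (hne : (w k).1 ≠ (w j).1) :
    rank w (k + 1) j = if rank w k k ≤ rank w k j then rank w k j + 1 else rank w k j := by
  have : (w k).1 < (w j).1 ↔ rank w k k ≤ rank w k j := by
    rw [← le_iff_rank_le hj, lt_iff_le_and_ne, and_iff_left hne]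
  rw [rank_succ, if_congr this rfl rfl]
  split_ifs <;> rfl

theorem rank_succ_cases {w : ℕ → ℝ × Bool} (hw : Function.Injective fun i => (w i).1) {k j : ℕ}
    (hj : j < k) : (rank w k k ≤ rank w k j ∧ rank w (k + 1) j = rank w k j + 1) ∨
      (rank w k j < rank w k k ∧ rank w (k + 1) j = rank w k j) := by
  rw [rank_succ_eq hj fun h => hj.ne' (hw h)]
  split_ifs <;> omega

/-- The list element `q` describes one of the first `k` points of `w`, which a later point in one of
the gaps from `q.lo` to `q.hi` sees past the other points and the rectangles of `A`. -/
def Tracks (w : ℕ → ℝ × Bool) (k : ℕ) (A : Finset (ℕ × ℕ)) (q : Pending) : Prop :=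
  ∃ i < k, rank w k i = q.pos ∧ (w i).2 = q.col ∧ q.lo ≤ q.pos ∧ q.pos < q.hi ∧
    (∀ j, i < j → j < k → rank w k j < q.lo ∨ q.hi ≤ rank w k j) ∧
    ∀ e ∈ A, i ≤ e.2 → (rank w k e.1 < q.lo ∧ rank w k e.2 < q.lo) ∨
      (q.hi ≤ rank w k e.1 ∧ q.hi ≤ rank w k e.2)

/-- The invariant of the sweep: the first `k` points of `w` have a matching with `m` rectangles, and
the list `s` describes pending points. -/
def Invariant (w : ℕ → ℝ × Bool) (k : ℕ) (s : List Pending) (m : ℕ) : Prop :=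
  ∃ A, IsPairing (graphPoint w) (Set.Iio k) A ∧ A.card = m ∧ (∀ e ∈ A, e.1 < e.2) ∧
    ∀ q ∈ s, Tracks w k A q

/-- The new point raises by one every rank that is at least its own. Whatever it adds lies in the
ranks from `a` to `b`, and the interval of visible gaps is cut back to the side of this obstacle on
which the tracked point lies. -/
theorem Tracks.obstruct {w : ℕ → ℝ × Bool} (hw : Function.Injective fun i => (w i).1) {k : ℕ}
    {A A' : Finset (ℕ × ℕ)} {q q' : Pending} (h : Tracks w k A q) {a b : ℕ}
    (ha : a ≤ rank w k k) (hb : rank w k k ≤ b)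
    (hq : q.obstruct (rank w k k) a b = some q') (hA : ∀ e ∈ A, e.1 < k ∧ e.2 < k)
    (hA' : ∀ e ∈ A', e ∈ A ∨ (a ≤ rank w (k + 1) e.1 ∧ rank w (k + 1) e.1 ≤ b) ∧
      a ≤ rank w (k + 1) e.2 ∧ rank w (k + 1) e.2 ≤ b) : Tracks w (k + 1) A' q' := by
  obtain ⟨i, hik, hpos, hcol, hlo, hhi, hpts, hbox⟩ := h
  have hk := rank_succ_self w k
  have hi := rank_succ_cases hw hik
  simp only [Pending.obstruct] at hq
  generalize hp : (if rank w k k ≤ q.pos then q.pos + 1 else q.pos) = p at hq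
  generalize hl : (if rank w k k < q.lo then q.lo + 1 else q.lo) = l at hq
  generalize hh : (if rank w k k ≤ q.hi then q.hi + 1 else q.hi) = h at hq
  replace hp : (rank w k k ≤ q.pos ∧ p = q.pos + 1) ∨ (q.pos < rank w k k ∧ p = q.pos) := by
    split_ifs at hp <;> omega
  replace hl : (rank w k k < q.lo ∧ l = q.lo + 1) ∨ (q.lo ≤ rank w k k ∧ l = q.lo) := by
    split_ifs at hl <;> omega
  replace hh : (rank w k k ≤ q.hi ∧ h = q.hi + 1) ∨ (q.hi < rank w k k ∧ h = q.hi) := by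
    split_ifs at hh <;> omega
  refine ⟨i, by omega, ?_⟩
  split_ifs at hq
  all_goals
    obtain rfl := Option.some.inj hq
    dsimp only
    refine ⟨by omega, hcol, by omega, by omega, ?_, ?_⟩
    · intro j hij hj
      rcases Nat.lt_succ_iff_lt_or_eq.1 hj with hj | rfl
      · have := hpts j hij hj
        have := rank_succ_cases hw hj
        omega
      · omega
    · intro e he hie
      rcases hA' e he with he | he
      · have := hbox e he hie
        have := rank_succ_cases hw (hA e he).1
        have := rank_succ_cases hw (hA e he).2
        omega
      · omega

/-- An unmatched new point obstructs only its own rank. Nothing lies to its right yet, so all gaps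
from 0 to `k + 1` see it. -/
theorem Invariant.keep {w : ℕ → ℝ × Bool} (hw : Function.Injective fun i => (w i).1) {k m : ℕ}
    {s : List Pending} (h : Invariant w k s m) :
    Invariant w (k + 1) (⟨rank w k k, (w k).2, 0, k + 1⟩ ::
      s.filterMap (Pending.obstruct (rank w k k) (rank w k k) (rank w k k))) m := by
  obtain ⟨A, hA, hm, hlt, hs⟩ := h
  have hAk : ∀ e ∈ A, e.1 < k ∧ e.2 < k := fun e he => ⟨hA.left_mem e he, hA.right_mem e he⟩
  refine ⟨A, ⟨fun e he => ?_, fun e he => ?_, hA.ne, hA.color, fun e he i hi hm => ?_,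
    hA.disjoint⟩, hm, hlt, fun q hq => ?_⟩
  · exact (hAk e he).1.trans (Nat.lt_succ_self k)
  · exact (hAk e he).2.trans (Nat.lt_succ_self k)
  · rcases Nat.lt_succ_iff_lt_or_eq.1 (Set.mem_Iio.1 hi) with hi | rfl
    · exact hA.covers e he i hi hm
    · have := hm.1
      rw [Set.mem_uIcc] at this
      simp only [graphPoint, Nat.cast_le] at this
      have := hAk e he
      omega
  · rcases List.mem_cons.1 hq with rfl | hq
    · refine ⟨k, Nat.lt_succ_self k, rank_succ_self w k, rfl, Nat.zero_le _, ?_, ?_, ?_⟩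
      · exact Nat.lt_succ_of_le (rank_le w k k)
      · intro j hj hj'
        omega
      · intro e he hk
        exact absurd (hAk e he).2 (by omega)
    · obtain ⟨q', hq', hqq⟩ := List.mem_filterMap.1 hq
      exact (hs q' hq').obstruct hw le_rfl le_rfl hqq hAk fun e he => Or.inl he

/-- The new box spans the ranks from `a` to `b`, counted after the arrival. Both matched points have
ranks in this range, so `Pending.obstruct` also removes the old partner from the list. -/
theorem Invariant.match_pending {w : ℕ → ℝ × Bool} (hw : Function.Injective fun i => (w i).1)
    {k m : ℕ} {s : List Pending} (h : Invariant w k s m) {q : Pending} (hq : q ∈ s)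
    (hcol : q.col = (w k).2) (hlo : q.lo ≤ rank w k k) (hhi : rank w k k ≤ q.hi) {a b : ℕ}
    (hab : if rank w k k ≤ q.pos then a = rank w k k ∧ b = q.pos + 1
      else a = q.pos ∧ b = rank w k k) :
    Invariant w (k + 1) (s.filterMap (Pending.obstruct (rank w k k) a b)) (m + 1) := by
  obtain ⟨A, hA, hm, hlt, hs⟩ := h
  have hAk : ∀ e ∈ A, e.1 < k ∧ e.2 < k := fun e he => ⟨hA.left_mem e he, hA.right_mem e he⟩
  obtain ⟨i, hik, hpos, hicol, hqlo, hqhi, hpts, hbox⟩ := hs q hq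
  have hk := rank_succ_self w k
  have hki := rank_succ_cases hw hik
  replace hab : (rank w k k ≤ q.pos ∧ a = rank w k k ∧ b = q.pos + 1) ∨
      (q.pos < rank w k k ∧ a = q.pos ∧ b = rank w k k) := by
    split_ifs at hab <;> omega
  have hins : (i, k) ∉ A := fun hmem => absurd (hAk _ hmem).2 (lt_irrefl k)
  -- The new rectangle lies above or below the older ones that reach beyond the point `i`.
  have hnew : ∀ e ∈ A, Disjoint (box (graphPoint w) (i, k)) (box (graphPoint w) e) := by
    intro e he
    have h1 := hAk e he
    have h2 := hlt e he
    rw [disjoint_box_iff, disjoint_uIcc_iff, disjoint_uIcc_iff]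
    simp only [graphPoint, Nat.cast_lt]
    by_cases hie : i ≤ e.2
    · have := hbox e he hie
      right
      rw [lt_iff_rank_lt (k := k + 1) (by omega), lt_iff_rank_lt (k := k + 1) (by omega),
        lt_iff_rank_lt (k := k + 1) (by omega), lt_iff_rank_lt (k := k + 1) (by omega),
        lt_iff_rank_lt (k := k + 1) (by omega), lt_iff_rank_lt (k := k + 1) (by omega),
        lt_iff_rank_lt (k := k + 1) (by omega), lt_iff_rank_lt (k := k + 1) (by omega)]
      have := rank_succ_cases hw h1.1
      have := rank_succ_cases hw h1.2
      omega
    · left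
      omega
  refine ⟨insert (i, k) A, ⟨?_, ?_, ?_, ?_, ?_, ?_⟩, ?_, ?_, ?_⟩
  · intro e he
    rcases Finset.mem_insert.1 he with rfl | he
    · exact Set.mem_Iio.2 (by simp only; omega)
    · exact Set.mem_Iio.2 (by have := hAk e he; omega)
  · intro e he
    rcases Finset.mem_insert.1 he with rfl | he
    · exact Set.mem_Iio.2 (by simp)
    · exact Set.mem_Iio.2 (by have := hAk e he; omega)
  · intro e he
    rcases Finset.mem_insert.1 he with rfl | he
    · exact hik.ne
    · exact hA.ne e he
  · intro e he
    rcases Finset.mem_insert.1 he with rfl | he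
    · exact hicol.trans hcol
    · exact hA.color e he
  · intro e he j hj hmem
    rcases Finset.mem_insert.1 he with rfl | he
    · by_contra hc
      rw [not_or] at hc
      have hj' : j < k := by
        have := Set.mem_Iio.1 hj
        have := hc.2
        simp only at this
        omega
      have hx := hmem.1
      have hy := hmem.2
      rw [Set.mem_uIcc] at hx hy
      simp only [graphPoint, Nat.cast_le] at hx hy
      rw [le_iff_rank_le (k := k + 1) (by omega), le_iff_rank_le (k := k + 1) (by omega),
        le_iff_rank_le (k := k + 1) (by omega), le_iff_rank_le (k := k + 1) (by omega)] at hy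
      have := rank_succ_cases hw hj'
      have hc1 := hc.1
      simp only at hc1
      -- A further point in the box would be later than `i` and have its rank in the visible
      -- interval of `q`.
      have := hpts j (by omega) hj'
      omega
    · have hek := hAk e he
      rcases Nat.lt_succ_iff_lt_or_eq.1 (Set.mem_Iio.1 hj) with hj | rfl
      · exact hA.covers e he j hj hmem
      · have := hmem.1
        rw [Set.mem_uIcc] at this
        simp only [graphPoint, Nat.cast_le] at this
        omega
  · intro e he e' he' hne
    rcases Finset.mem_insert.1 he with rfl | he <;> rcases Finset.mem_insert.1 he' with rfl | he'
    · exact absurd rfl hne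
    · exact hnew e' he'
    · exact (hnew e he).symm
    · exact hA.disjoint e he e' he' hne
  · rw [Finset.card_insert_of_notMem hins, hm]
  · intro e he
    rcases Finset.mem_insert.1 he with rfl | he
    · exact hik
    · exact hlt e he
  · intro r hr
    obtain ⟨q', hq', hqq⟩ := List.mem_filterMap.1 hr
    refine (hs q' hq').obstruct hw ?_ ?_ hqq hAk fun e he => ?_
    · omega
    · omega
    · rcases Finset.mem_insert.1 he with rfl | he
      · right
        dsimp only
        omega
      · exact Or.inl he

theorem Invariant.mono {w : ℕ → ℝ × Bool} {k m : ℕ} {s s' : List Pending}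
    (h : Invariant w k s m) (hs : ∀ q ∈ s', q ∈ s) : Invariant w k s' m := by
  obtain ⟨A, hA, hm, hlt, h⟩ := h
  exact ⟨A, hA, hm, hlt, fun q hq => h q (hs q hq)⟩

theorem invariant_zero (w : ℕ → ℝ × Bool) : Invariant w 0 [] 0 :=
  ⟨∅, ⟨by simp, by simp, by simp, by simp, by simp, by simp⟩, by simp, by simp, by simp⟩

theorem Invariant.card_add_le {w : ℕ → ℝ × Bool} {k m : ℕ} {s : List Pending}
    (h : Invariant w k s m) (n : ℕ) : 2 * m + windowMax w k n ≤ windowMax w 0 (k + n) := by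
  obtain ⟨A, hA, rfl, -, -⟩ := h
  exact two_mul_card_add_windowMax_le hA

/-! ### Certificates linking the computation with the sweep. -/

/-- A point of colour `c` in the gap `g` turns the list `s` into `s'` and adds `r` rectangles. -/
def IsMove (k : ℕ) (s : List Pending) (g : ℕ) (c : Bool) (r : ℕ) (s' : List Pending) : Prop :=
  ∀ w : ℕ → ℝ × Bool, (Function.Injective fun i => (w i).1) → ∀ m, Invariant w k s m →
    rank w k k = g → (w k).2 = c → Invariant w (k + 1) s' (m + r)

/-- The excess `x` can be reached, in units of `1 / (1000 * units d k)`, with at most `d` further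
points after the first `k`, when the pending points are `s`. -/
inductive Achieves : ℕ → ℕ → List Pending → ℕ → Prop
  | rest (d k : ℕ) (s : List Pending) : Achieves d k s 0
  | step (d k : ℕ) (s : List Pending) (r x : ℕ → Bool → ℕ) (s' : ℕ → Bool → List Pending)
      (hmove : ∀ g c, IsMove k s g c (r g c) (s' g c))
      (hnext : ∀ g c, Achieves d (k + 1) (s' g c) (x g c)) :
      Achieves (d + 1) k s (∑ g ∈ Finset.range (k + 1),
        ((2000 * units d (k + 1) * r g true + x g true) +
          (2000 * units d (k + 1) * r g false + x g false)) - 831 * units (d + 1) k)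

theorem addPending_eq {α : Type} (e : Bool) (k : List Pending → α) (x : Pending)
    (t : List Pending) : ∃ t', (∀ q ∈ t', q ∈ x :: t) ∧ addPending e k x t = k t' := by
  cases t with
  | nil => exact ⟨[x], by simp, rfl⟩
  | cons q t =>
    cases e
    · exact ⟨x :: q :: t, by simp, rfl⟩
    · exact ⟨[x, q], by simp, rfl⟩

/-- The successor list does not depend on the continuation `v`, so `gain` is the reward of a genuine
move plus `v` at its outcome. -/
theorem exists_isMove_gain (e : Bool) (u g : ℕ) (c : Bool) (s : List Pending) (k : ℕ) :
    ∃ r s', IsMove k s g c r s' ∧ (r = 1 ↔ ∃ p, partner g c s = some p) ∧ r ≤ 1 ∧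
      ∀ v, gain e u g c s (k + 1) v = 2000 * u * r + v s' := by
  cases hp : partner g c s with
  | some p =>
    obtain ⟨q, hq, rfl, hcol, hlo, hhi⟩ := partner_eq_some hp
    refine ⟨1, s.filterMap (Pending.obstruct g (bif g.ble q.pos then g else q.pos)
      (bif g.ble q.pos then q.pos + 1 else g)), ?_, by simp, le_rfl, fun v => ?_⟩
    · rintro w hw m hI rfl hc
      refine hI.match_pending hw hq (hcol.trans hc.symm) hlo hhi ?_
      simp only [Bool.cond_eq_ite, Nat.ble_eq]
      split_ifs <;> simp
    · simp only [gain, hp, forceNat_eq, block_eq, mul_one]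
  | none =>
    obtain ⟨t', ht, ht'⟩ := addPending_eq e id ⟨g, c, 0, k + 1⟩
      (s.filterMap (Pending.obstruct g g g))
    refine ⟨0, t', ?_, by simp, zero_le_one, fun v => ?_⟩
    · rintro w hw m hI rfl rfl
      exact (hI.keep hw).mono ht
    · simp only [gain, hp, block_eq, mul_zero, zero_add]
      rw [show t' = id t' from rfl, ← ht']
      cases s.filterMap (Pending.obstruct g g g)
      · rfl
      · cases e <;> rfl

theorem achieves_value (d k : ℕ) (s : List Pending) : Achieves (d + 1) k s (value d k s) := by
  induction d generalizing k s with
  | zero =>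
    choose r s' hmove hr hr' hgain using fun g c => exists_isMove_gain false 1 g c s k
    have hlast : ∀ g c, lastGain g c s = 2000 * units 0 (k + 1) * r g c + 0 := by
      intro g c
      have h1 := hr g c
      have h2 := hr' g c
      rw [lastGain]
      cases hp : partner g c s with
      | some p => simp [h1.2 ⟨p, hp⟩, units]
      | none =>
        have : r g c ≠ 1 := fun h => by simpa [hp] using h1.1 h
        have : r g c = 0 := by omega
        simp [this]
    have := Achieves.step 0 k s r (fun _ _ => 0) s' hmove fun g c => .rest _ _ _
    convert this using 1
    change sumTo (fun g => lastGain g true s + lastGain g false s) k - 831 * units 1 k = _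
    simp only [sumTo_eq, hlast]
  | succ d ih =>
    cases s with
    | nil => exact .rest _ _ _
    | cons q t =>
      choose r s' hmove hr hr' hgain using
        fun g c => exists_isMove_gain (d.ble 2) (units (d + 1) (k + 1)) g c (q :: t) k
      have := Achieves.step (d + 1) k (q :: t) r (fun g c => value d (k + 1) (s' g c)) s' hmove
        fun g c => ih _ _
      convert this using 1
      change forceNat (k + 1) (fun k' =>
        sumTo (fun g => gain (d.ble 2) (units (d + 1) k') g true (q :: t) k' (value d k') +
        gain (d.ble 2) (units (d + 1) k') g false (q :: t) k' (value d k')) k -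
          831 * units (d + 2) k) = _
      simp only [forceNat_eq, sumTo_eq, hgain]

theorem isMove_first (c : Bool) : IsMove 0 [] 0 c 0 [⟨0, c, 0, 1⟩] := by
  rintro w hw m hI h0 rfl
  have := hI.keep hw
  rw [h0] at this
  exact this


/-- The only numerical input. Since `units 8 0 = 2 * units 7 1`, it says that after the first point
the expected excess over the two colours averages at least 0.831, which pays for the first point
itself. -/
theorem le_value_first : 831 * units 8 0 ≤
    value 6 1 [⟨0, true, 0, 1⟩] + value 6 1 [⟨0, false, 0, 1⟩] := by
  decide +kernel


/-! ### Measurability, and reduction of the expectation to sorted configurations. -/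

theorem measurable_maxCovered (n : ℕ) :
    Measurable (maxCovered : (Fin n → ColoredPoint) → ℕ) := by
  -- The comparisons and colours take finitely many values and determine `maxCovered`, so
  -- measurability of this code suffices.
  let code : (Fin n → ColoredPoint) → (Fin n → Fin n → Prop × Prop) × (Fin n → Bool) := fun z =>
    (fun i j => ((z i).1.1 ≤ (z j).1.1, (z i).1.2 ≤ (z j).1.2), fun i => (z i).2)
  have hcode : Measurable code := by
    refine Measurable.prodMk (measurable_pi_iff.2 fun i => measurable_pi_iff.2 fun j =>
      Measurable.prodMk ?_ ?_) (by fun_prop)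
    · exact measurableSet_setOfPred.1 (measurableSet_le (by fun_prop) (by fun_prop))
    · exact measurableSet_setOfPred.1 (measurableSet_le (by fun_prop) (by fun_prop))
  have hfac : Function.FactorsThrough (maxCovered : (Fin n → ColoredPoint) → ℕ) code := by
    intro z z' h
    simp only [code, Prod.mk.injEq, funext_iff, eq_iff_iff] at h
    exact maxCovered_eq_of_order (Equiv.refl _) (fun i => (h.2 i).symm)
      (fun i j => (h.1 i j).1.symm) fun i j => (h.1 i j).2.symm
  have : (maxCovered : (Fin n → ColoredPoint) → ℕ) =
      Function.extend code maxCovered (fun _ => 0) ∘ code := by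
    funext z
    exact (hfac.extend_apply _ z).symm
  rw [this]
  exact (measurable_of_countable _).comp hcode

theorem measurePreserving_perm {α : Type*} [MeasurableSpace α] (μ : Measure α) [SigmaFinite μ]
    {n : ℕ} (σ : Equiv.Perm (Fin n)) :
    MeasurePreserving (fun (u : Fin n → α) i => u (σ i)) (Measure.pi fun _ => μ)
      (Measure.pi fun _ => μ) := by
  convert measurePreserving_piCongrLeft (fun _ : Fin n => μ) σ.symm using 1
  funext u i
  obtain ⟨j, rfl⟩ := σ.symm.surjective i
  rw [MeasurableEquiv.coe_piCongrLeft, Equiv.piCongrLeft_apply_apply, Equiv.apply_symm_apply]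

theorem ae_injective_of_iIndepFun {Ω ι : Type*} [Countable ι] [MeasurableSpace Ω] {P : Measure Ω}
    [IsProbabilityMeasure P] {X : ι → Ω → ℝ} (hX : iIndepFun X P) (hm : ∀ i, Measurable (X i))
    (hna : ∀ i, NullSingletonClass (P.map (X i))) : ∀ᵐ ω ∂P, Function.Injective fun i => X i ω := by
  have hij : ∀ i j, i ≠ j → ∀ᵐ ω ∂P, X i ω ≠ X j ω := by
    intro i j hne
    have hmap := (indepFun_iff_map_prod_eq_prod_map_map (hm i).aemeasurable
      (hm j).aemeasurable).1 (hX.indepFun hne)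
    have := hna j
    have hs : MeasurableSet {p : ℝ × ℝ | p.1 = p.2} :=
      measurableSet_eq_fun measurable_fst measurable_snd
    have h0 : (P.map (fun ω => (X i ω, X j ω))) {p : ℝ × ℝ | p.1 = p.2} = 0 := by
      have : IsProbabilityMeasure (P.map (X j)) :=
        Measure.isProbabilityMeasure_map (hm j).aemeasurable
      rw [hmap, Measure.measure_prod_null hs]
      refine Eventually.of_forall fun x => ?_
      have : Prod.mk x ⁻¹' {p : ℝ × ℝ | p.1 = p.2} = {x} := by
        ext y
        simp [eq_comm]
      simp [this]
    rw [Measure.map_apply ((hm i).prodMk (hm j)) hs] at h0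
    exact measure_eq_zero_iff_ae_notMem.1 h0
  have : ∀ᵐ ω ∂P, ∀ i j, i ≠ j → X i ω ≠ X j ω := by
    rw [ae_all_iff]
    intro i
    rw [ae_all_iff]
    intro j
    by_cases h : i = j
    · simp [h]
    · simpa [h] using hij i j h
  filter_upwards [this] with ω hω i j h
  by_contra hne
  exact hω i j hne h

/-- The uniform law on `[0, 1]`. -/
noncomputable def unitLaw : Measure ℝ := volume.restrict (Set.Icc 0 1)

instance : IsProbabilityMeasure unitLaw := ⟨by simp [unitLaw]⟩

instance : NullSingletonClass unitLaw := by
  unfold unitLaw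
  infer_instance

/-- The law of a fair colour. -/
noncomputable def colorLaw : Measure Bool := uniformOn (Set.univ : Set Bool)

instance : IsProbabilityMeasure colorLaw := by
  unfold colorLaw
  infer_instance

theorem colorLaw_singleton (b : Bool) : colorLaw {b} = 2⁻¹ := by
  rw [colorLaw, uniformOn_univ]
  simp

/-- The law of an ordinate together with a colour. -/
noncomputable def heightLaw : Measure (ℝ × Bool) := unitLaw.prod colorLaw

instance : IsProbabilityMeasure heightLaw := by
  unfold heightLaw
  infer_instance

/-- The law of a sequence of independent random ordinates and colours. -/
noncomputable def seqLaw : Measure (ℕ → ℝ × Bool) := Measure.infinitePi fun _ => heightLaw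

instance : IsProbabilityMeasure seqLaw := by
  unfold seqLaw
  infer_instance

theorem iIndepFun_eval_seqLaw : iIndepFun (fun (i : ℕ) (w : ℕ → ℝ × Bool) => w i) seqLaw :=
  iIndepFun_infinitePi (P := fun _ : ℕ => heightLaw) (X := fun _ p => p)
    (fun _ => measurable_id)

theorem map_eval_seqLaw (i : ℕ) : seqLaw.map (fun w => w i) = heightLaw :=
  (measurePreserving_eval_infinitePi (fun _ : ℕ => heightLaw) i).map_eq

theorem measurePreserving_window (a n : ℕ) :
    MeasurePreserving (fun (w : ℕ → ℝ × Bool) (i : Fin n) => w (a + i)) seqLaw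
      (Measure.pi fun _ => heightLaw) := by
  refine ⟨by fun_prop, ?_⟩
  have h := iIndepFun_eval_seqLaw.precomp (windowEmb a n).injective
  rw [iIndepFun_iff_map_fun_eq_pi_map
    (fun i => (measurable_pi_apply (windowEmb a n i)).aemeasurable)] at h
  have h' : (fun i : Fin n => seqLaw.map fun w => w (windowEmb a n i)) = fun _ => heightLaw :=
    funext fun i => map_eval_seqLaw _
  exact h.trans (by rw [h'])

theorem ae_injective_seqLaw : ∀ᵐ w ∂seqLaw, Function.Injective fun i => (w i).1 := by
  refine ae_injective_of_iIndepFun (X := fun i (w : ℕ → ℝ × Bool) => (w i).1)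
    (iIndepFun_eval_seqLaw.comp (fun _ p => p.1) fun _ => measurable_fst)
    (fun i => by fun_prop) fun i => ?_
  have : seqLaw.map (fun w => (w i).1) = unitLaw := by
    have h := map_eval_seqLaw i
    have h2 : (seqLaw.map fun w => w i).map Prod.fst = unitLaw := by
      rw [h, heightLaw, ← Measure.fst, Measure.fst_prod]
    rwa [Measure.map_map measurable_fst (by fun_prop)] at h2
  rw [this]
  infer_instance

theorem ae_injective_pi_unitLaw (n : ℕ) :
    ∀ᵐ x ∂(Measure.pi fun _ : Fin n => unitLaw), Function.Injective x := by
  refine ae_injective_of_iIndepFun (X := fun (i : Fin n) (x : Fin n → ℝ) => x i)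
    (iIndepFun_pi (X := fun _ p => p) fun _ => aemeasurable_id) (fun i => by fun_prop) fun i => ?_
  rw [(measurePreserving_eval (fun _ : Fin n => unitLaw) i).map_eq]
  infer_instance

/-- The configuration with abscissas `0, …, n - 1` and the given ordinates and colours. -/
def gridConfig {n : ℕ} (u : Fin n → ℝ × Bool) (i : Fin n) : ColoredPoint :=
  ((((i : ℕ) : ℝ), (u i).1), (u i).2)

theorem measurable_gridConfig (n : ℕ) : Measurable (gridConfig : (Fin n → ℝ × Bool) → _) := by
  unfold gridConfig
  fun_prop

theorem windowMax_eq_gridConfig (w : ℕ → ℝ × Bool) (a n : ℕ) :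
    windowMax w a n = maxCovered (gridConfig fun i : Fin n => w (a + i)) :=
  maxCovered_eq_of_order (Equiv.refl _) (fun _ => rfl)
    (fun i j => by simp [gridConfig, graphPoint]) fun i j => by simp [gridConfig, graphPoint]

theorem measurable_windowMax (a n : ℕ) : Measurable fun w => windowMax w a n := by
  simp_rw [windowMax_eq_gridConfig]
  exact (measurable_maxCovered n).comp ((measurable_gridConfig n).comp (by fun_prop))

theorem windowMax_le (w : ℕ → ℝ × Bool) (a n : ℕ) : windowMax w a n ≤ n := maxCovered_le _

theorem _root_.Measurable.natCast_real {α : Type*} [MeasurableSpace α] {f : α → ℕ}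
    (hf : Measurable f) : Measurable fun a => (f a : ℝ) :=
  (measurable_from_top (f := fun k : ℕ => (k : ℝ))).comp hf

theorem integrable_of_nat_le {α : Type*} [MeasurableSpace α] {μ : Measure α} [IsFiniteMeasure μ]
    {f : α → ℕ} (hf : Measurable f) {n : ℕ} (h : ∀ a, f a ≤ n) :
    Integrable (fun a => (f a : ℝ)) μ := by
  refine Integrable.of_bound (C := n) hf.natCast_real.aestronglyMeasurable
    (Eventually.of_forall fun a => ?_)
  simpa using h a

theorem integrable_windowMax (a n : ℕ) : Integrable (fun w => (windowMax w a n : ℝ)) seqLaw :=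
  integrable_of_nat_le (measurable_windowMax a n) fun w => windowMax_le w a n

/-- The expected number of covered points for `n` points in the order of their abscissas. -/
noncomputable def gridMean (n : ℕ) : ℝ :=
  ∫ u, (maxCovered (gridConfig u) : ℝ) ∂(Measure.pi fun _ : Fin n => heightLaw)

theorem integral_windowMax (a n : ℕ) : ∫ w, (windowMax w a n : ℝ) ∂seqLaw = gridMean n := by
  simp_rw [windowMax_eq_gridConfig]
  rw [gridMean, ← (measurePreserving_window a n).map_eq, integral_map
    (measurePreserving_window a n).measurable.aemeasurable]
  exact ((measurable_maxCovered n).comp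
    (measurable_gridConfig n)).natCast_real.aestronglyMeasurable

theorem gridMean_nonneg (n : ℕ) : 0 ≤ gridMean n := integral_nonneg fun _ => Nat.cast_nonneg _

theorem gridMean_le (n : ℕ) : gridMean n ≤ n := by
  have : ∫ w, (windowMax w 0 n : ℝ) ∂seqLaw ≤ ∫ _, (n : ℝ) ∂seqLaw :=
    integral_mono (integrable_windowMax 0 n) (integrable_const _) fun w => by
      exact Nat.cast_le.2 (windowMax_le w 0 n)
  simpa [integral_windowMax] using this

theorem gridMean_add_le (m n : ℕ) : gridMean m + gridMean n ≤ gridMean (m + n) := by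
  rw [← integral_windowMax 0 m, ← integral_windowMax m n, ← integral_windowMax 0 (m + n),
    ← integral_add (integrable_windowMax 0 m) (integrable_windowMax m n)]
  refine integral_mono ((integrable_windowMax 0 m).add (integrable_windowMax m n))
    (integrable_windowMax 0 (m + n)) fun w => ?_
  exact_mod_cast windowMax_add_windowMax_le w m n

theorem coloredPointLaw_eq : coloredPointLaw = (unitLaw.prod unitLaw).prod colorLaw := by
  rw [coloredPointLaw, unitLaw, Measure.prod_restrict, Measure.volume_eq_prod, colorLaw]

instance : IsProbabilityMeasure coloredPointLaw := by
  rw [coloredPointLaw_eq]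
  infer_instance

instance (n : ℕ) : IsProbabilityMeasure (configLaw n) := by
  unfold configLaw
  infer_instance

theorem integrable_maxCovered (n : ℕ) :
    Integrable (fun z => (maxCovered z : ℝ)) (configLaw n) :=
  integrable_of_nat_le (measurable_maxCovered n) maxCovered_le

theorem measurePreserving_splitConfig (n : ℕ) :
    MeasurePreserving (fun z : Fin n → ColoredPoint =>
      ((fun i => (z i).1.1), fun i => ((z i).1.2, (z i).2))) (configLaw n)
      ((Measure.pi fun _ => unitLaw).prod (Measure.pi fun _ => heightLaw)) := by
  have h1 : MeasurePreserving (MeasurableEquiv.prodAssoc : ColoredPoint ≃ᵐ ℝ × (ℝ × Bool))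
      coloredPointLaw (unitLaw.prod heightLaw) := by
    refine ⟨MeasurableEquiv.measurable _, ?_⟩
    rw [coloredPointLaw_eq, heightLaw, Measure.prodAssoc_prod]
  have h2 := measurePreserving_pi (fun _ : Fin n => coloredPointLaw)
    (fun _ => unitLaw.prod heightLaw) fun _ => h1
  exact (measurePreserving_arrowProdEquivProdArrow ℝ (ℝ × Bool) (Fin n) (fun _ => unitLaw)
    fun _ => heightLaw).comp h2

theorem maxCovered_eq_gridConfig_sort {n : ℕ} {x : Fin n → ℝ} (hx : Function.Injective x)
    (u : Fin n → ℝ × Bool) :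
    maxCovered (fun i => ((x i, (u i).1), (u i).2)) =
      maxCovered (gridConfig fun i => u (Tuple.sort x i)) := by
  have hmono : StrictMono (x ∘ Tuple.sort x) :=
    (Tuple.monotone_sort x).strictMono_of_injective (hx.comp (Tuple.sort x).injective)
  refine (maxCovered_eq_of_order (z := gridConfig fun i => u (Tuple.sort x i))
    (z' := fun i => ((x i, (u i).1), (u i).2)) (Tuple.sort x) (fun i => rfl) (fun i j => ?_)
    fun i j => Iff.rfl).symm
  simp only [gridConfig, Nat.cast_le, Fin.val_fin_le]
  exact hmono.le_iff_le

/-- Abscissas are independent of ordinates and colours. For fixed distinct abscissas, sorting merely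
permutes the i.i.d. pairs of ordinate and colour, which preserves their law. -/
theorem expectedMax_eq_gridMean (n : ℕ) : expectedMax n = gridMean n := by
  have hF : Measurable fun p : (Fin n → ℝ) × (Fin n → ℝ × Bool) =>
      maxCovered fun i => ((p.1 i, (p.2 i).1), (p.2 i).2) :=
    (measurable_maxCovered n).comp (by fun_prop)
  have h1 : expectedMax n = ∫ p, ((maxCovered fun i => ((p.1 i, (p.2 i).1), (p.2 i).2) : ℕ) : ℝ)
      ∂((Measure.pi fun _ : Fin n => unitLaw).prod (Measure.pi fun _ => heightLaw)) := by
    rw [← (measurePreserving_splitConfig n).map_eq, integral_map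
      (measurePreserving_splitConfig n).measurable.aemeasurable
      hF.natCast_real.aestronglyMeasurable]
    rfl
  rw [h1, integral_prod _ (integrable_of_nat_le hF fun _ => maxCovered_le _)]
  have h2 : ∀ᵐ x ∂(Measure.pi fun _ : Fin n => unitLaw),
      ∫ u, ((maxCovered fun i => ((x i, (u i).1), (u i).2) : ℕ) : ℝ)
        ∂(Measure.pi fun _ : Fin n => heightLaw) = gridMean n := by
    filter_upwards [ae_injective_pi_unitLaw n] with x hx
    simp_rw [maxCovered_eq_gridConfig_sort hx]
    have hp := measurePreserving_perm heightLaw (Tuple.sort x)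
    rw [gridMean]
    conv_rhs => rw [← hp.map_eq]
    rw [integral_map hp.measurable.aemeasurable]
    exact ((measurable_maxCovered n).comp
      (measurable_gridConfig n)).natCast_real.aestronglyMeasurable
  rw [integral_congr_ae h2]
  simp


/-! ### Relative ranks are uniform and independent. -/

theorem rank_congr {w w' : ℕ → ℝ × Bool} {k j : ℕ} (h : ∀ l < k, (w l).1 = (w' l).1)
    (hj : (w j).1 = (w' j).1) : rank w k j = rank w' k j := by
  unfold rank
  congr 1
  refine Finset.filter_congr fun l hl => ?_
  rw [h l (Finset.mem_range.1 hl), hj]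

theorem measurable_rank (k j : ℕ) : Measurable fun w => rank w k j := by
  simp only [rank, Finset.card_filter]
  refine Finset.measurable_sum _ fun l _ => ?_
  exact Measurable.ite (measurableSet_lt (by fun_prop) (by fun_prop)) measurable_const
    measurable_const

/-- The sequences whose first `k` ordinates have prescribed ranks among the earlier ones, and whose
first `k` colours are prescribed. -/
def cylinderSet (k : ℕ) (g : ℕ → ℕ) (c : ℕ → Bool) : Set (ℕ → ℝ × Bool) :=
  {w | ∀ i < k, rank w i i = g i ∧ (w i).2 = c i}

theorem measurableSet_cylinderSet (k : ℕ) (g : ℕ → ℕ) (c : ℕ → Bool) :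
    MeasurableSet (cylinderSet k g c) := by
  have : cylinderSet k g c =
      ⋂ i, ⋂ _ : i < k, {w | rank w i i = g i} ∩ {w : ℕ → ℝ × Bool | (w i).2 = c i} := by
    ext w
    simp [cylinderSet]
  rw [this]
  refine MeasurableSet.iInter fun i => MeasurableSet.iInter fun _ => MeasurableSet.inter ?_ ?_
  · exact measurable_rank i i (measurableSet_singleton (g i))
  · exact (measurable_snd.comp (measurable_pi_apply i)) (measurableSet_singleton (c i))

theorem mem_cylinderSet_congr {k : ℕ} {g : ℕ → ℕ} {c : ℕ → Bool} {w w' : ℕ → ℝ × Bool}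
    (h : ∀ i < k, w i = w' i) : w ∈ cylinderSet k g c ↔ w' ∈ cylinderSet k g c := by
  refine forall₂_congr fun i hi => ?_
  rw [h i hi, rank_congr (fun l hl => by rw [h l (hl.trans hi)]) (by rw [h i hi])]

/-- Extend a finite sequence of ordinates by zeros, and give it the colours `c`. -/
noncomputable def extendHeights {k : ℕ} (c : ℕ → Bool) (y : Fin k → ℝ) (i : ℕ) : ℝ × Bool :=
  (if h : i < k then y ⟨i, h⟩ else 0, c i)

theorem extendHeights_fst {k : ℕ} (c : ℕ → Bool) (y : Fin k → ℝ) (i : Fin k) :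
    (extendHeights c y i).1 = y i := by
  simp [extendHeights]

theorem measurable_extendHeights {k : ℕ} (c : ℕ → Bool) :
    Measurable (extendHeights c : (Fin k → ℝ) → _) := by
  refine measurable_pi_iff.2 fun i => Measurable.prodMk ?_ measurable_const
  by_cases h : i < k
  · simpa [h] using measurable_pi_apply _
  · simp [h]

theorem rank_extendHeights {k : ℕ} (c : ℕ → Bool) (y : Fin k → ℝ) (j : Fin k) :
    rank (extendHeights c y) k j = (Finset.univ.filter fun l => y l < y j).card := by
  rw [rank, ← Finset.card_map Fin.valEmbedding]
  congr 1
  ext l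
  simp only [extendHeights_fst, Finset.mem_filter, Finset.mem_range, Finset.mem_map,
    Finset.mem_univ, true_and, Fin.valEmbedding_apply]
  constructor
  · rintro ⟨hl, h⟩
    exact ⟨⟨l, hl⟩, by rwa [extendHeights_fst c y ⟨l, hl⟩] at h, rfl⟩
  · rintro ⟨l, h, rfl⟩
    exact ⟨l.2, by rwa [extendHeights_fst]⟩

/-- Inserting the points one by one, the rank of each at its arrival determines the whole order, as
for the Lehmer code of a permutation. -/
theorem rank_eq_of_rank_self_eq {w w' : ℕ → ℝ × Bool} {k : ℕ}
    (hw : ∀ i < k, ∀ j < i, (w i).1 ≠ (w j).1) (hw' : ∀ i < k, ∀ j < i, (w' i).1 ≠ (w' j).1)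
    (h : ∀ i < k, rank w i i = rank w' i i) : ∀ j < k, rank w k j = rank w' k j := by
  induction k with
  | zero => simp
  | succ k ih =>
    intro j hj
    have hk := h k (Nat.lt_succ_self k)
    rcases Nat.lt_succ_iff_lt_or_eq.1 hj with hj | rfl
    · have := ih (fun i hi => hw i (by omega)) (fun i hi => hw' i (by omega))
        (fun i hi => h i (by omega)) j hj
      rw [rank_succ_eq hj (hw k (by omega) j hj), rank_succ_eq hj (hw' k (by omega) j hj), this, hk]
    · rw [rank_succ_self, rank_succ_self, hk]

theorem eq_perm_of_rank_self_eq {k : ℕ} (c : ℕ → Bool) {y : Fin k → ℝ}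
    (hy : Function.Injective y) {σ τ : Equiv.Perm (Fin k)}
    (h : ∀ i < k, rank (extendHeights c (y ∘ σ)) i i = rank (extendHeights c (y ∘ τ)) i i) :
    σ = τ := by
  have hne : ∀ ρ : Equiv.Perm (Fin k), ∀ i < k, ∀ j < i,
      (extendHeights c (y ∘ ρ) i).1 ≠ (extendHeights c (y ∘ ρ) j).1 := by
    intro ρ i hi j hj heq
    rw [extendHeights_fst c _ ⟨i, hi⟩, extendHeights_fst c _ ⟨j, hj.trans hi⟩] at heq
    have := ρ.injective (hy heq)
    simp only [Fin.mk.injEq] at this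
    omega
  have hr := rank_eq_of_rank_self_eq (hne σ) (hne τ) h
  let T : Fin k → ℕ := fun j => (Finset.univ.filter fun l => y l < y j).card
  have hT : ∀ i j, y i < y j → T i < T j := by
    intro i j hij
    apply Finset.card_lt_card
    rw [Finset.ssubset_iff_of_subset]
    · exact ⟨i, by simp [hij], by simp⟩
    · intro l hl
      simp only [Finset.mem_filter, Finset.mem_univ, true_and] at hl ⊢
      exact hl.trans hij
  have hTinj : Function.Injective T := by
    intro i j hij
    rcases lt_trichotomy (y i) (y j) with h | h | h
    · exact absurd hij (hT i j h).ne
    · exact hy h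
    · exact absurd hij (hT j i h).ne'
  have hTσ : ∀ (ρ : Equiv.Perm (Fin k)) (j : Fin k), rank (extendHeights c (y ∘ ρ)) k j =
      T (ρ j) := by
    intro ρ j
    rw [rank_extendHeights, ← Finset.card_map ρ.toEmbedding]
    congr 1
    ext l
    simp only [Finset.mem_map, Finset.mem_filter, Finset.mem_univ, true_and, Function.comp_apply,
      Equiv.coe_toEmbedding]
    constructor
    · rintro ⟨a, ha, rfl⟩
      exact ha
    · intro h
      exact ⟨ρ.symm l, by simpa using h, by simp⟩
  ext j
  have := hr j j.2
  rw [hTσ, hTσ] at this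
  rw [hTinj this]

theorem existsUnique_perm_rank {k : ℕ} (c : ℕ → Bool) {y : Fin k → ℝ}
    (hy : Function.Injective y) {g : ℕ → ℕ} (hg : ∀ i < k, g i ≤ i) :
    ∃! σ : Equiv.Perm (Fin k), ∀ i < k, rank (extendHeights c (y ∘ σ)) i i = g i := by
  let Φ : Equiv.Perm (Fin k) → (i : Fin k) → Fin (i + 1) := fun σ i =>
    ⟨rank (extendHeights c (y ∘ σ)) i i, Nat.lt_succ_of_le (rank_le _ _ _)⟩
  have hinj : Function.Injective Φ := by
    intro σ τ h
    refine eq_perm_of_rank_self_eq c hy fun i hi => ?_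
    have := congrFun h ⟨i, hi⟩
    simpa [Φ] using this
  -- Injectivity gives bijectivity because there are k! = 1 · 2 ⋯ k sequences of arrival ranks.
  have hcard : Fintype.card (Equiv.Perm (Fin k)) = Fintype.card ((i : Fin k) → Fin (i + 1)) := by
    rw [Fintype.card_perm, Fintype.card_fin, Fintype.card_pi]
    simp only [Fintype.card_fin]
    rw [Fin.prod_univ_eq_prod_range (fun i => i + 1) k, Finset.prod_range_add_one_eq_factorial]
  have hbij := (Fintype.bijective_iff_injective_and_card Φ).2 ⟨hinj, hcard⟩
  obtain ⟨σ, hσ⟩ := hbij.2 fun i => ⟨g i, Nat.lt_succ_of_le (hg i i.2)⟩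
  refine ⟨σ, fun i hi => ?_, fun τ hτ => eq_perm_of_rank_self_eq c hy fun i hi => ?_⟩
  · have := congrFun hσ ⟨i, hi⟩
    simpa [Φ] using this
  · have := congrFun hσ ⟨i, hi⟩
    rw [hτ i hi]
    simp only [Φ, Fin.mk.injEq] at this
    exact this.symm

/-- By exchangeability all k! permuted copies of the event have equal probability, and almost surely
exactly one of them occurs. -/
theorem unitLaw_pi_rank {k : ℕ} (c : ℕ → Bool) {g : ℕ → ℕ} (hg : ∀ i < k, g i ≤ i) :
    (Measure.pi fun _ : Fin k => unitLaw) {y | ∀ i < k, rank (extendHeights c y) i i = g i} =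
      (k.factorial : ENNReal)⁻¹ := by
  set μ := Measure.pi fun _ : Fin k => unitLaw
  set R : Set (Fin k → ℝ) := {y | ∀ i < k, rank (extendHeights c y) i i = g i} with hR
  have hRm : MeasurableSet R := by
    have : R = ⋂ i, ⋂ _ : i < k, {y | rank (extendHeights c y) i i = g i} := by
      ext y
      simp [hR]
    rw [this]
    exact MeasurableSet.iInter fun i => MeasurableSet.iInter fun _ =>
      ((measurable_rank i i).comp (measurable_extendHeights c)) (measurableSet_singleton (g i))
  have hσ : ∀ σ : Equiv.Perm (Fin k), ∫⁻ y, R.indicator 1 (y ∘ σ) ∂μ = μ R := by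
    intro σ
    have hp := measurePreserving_perm unitLaw σ
    have := hp.lintegral_comp (f := R.indicator (1 : (Fin k → ℝ) → ENNReal))
      (measurable_one.indicator hRm)
    rw [lintegral_indicator_one hRm] at this
    exact this
  have hsum : ∑ σ : Equiv.Perm (Fin k), ∫⁻ y, R.indicator (1 : (Fin k → ℝ) → ENNReal) (y ∘ σ) ∂μ
      = 1 := by
    have hm : ∀ σ : Equiv.Perm (Fin k),
        Measurable fun y : Fin k → ℝ => R.indicator (1 : (Fin k → ℝ) → ENNReal) (y ∘ σ) := fun σ =>
      (measurable_one.indicator hRm).comp (measurePreserving_perm unitLaw σ).measurable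
    rw [← lintegral_finsetSum _ fun σ _ => hm σ]
    have hae : ∀ᵐ y ∂μ, ∑ σ : Equiv.Perm (Fin k),
        R.indicator (1 : (Fin k → ℝ) → ENNReal) (y ∘ σ) = 1 := by
      filter_upwards [ae_injective_pi_unitLaw k] with y hy
      obtain ⟨σ, hσ, huniq⟩ := existsUnique_perm_rank c hy hg
      rw [Finset.sum_eq_single σ]
      · exact Set.indicator_of_mem (show y ∘ σ ∈ R from hσ) _
      · intro τ _ hne
        exact Set.indicator_of_notMem (fun hτ : y ∘ τ ∈ R => hne (huniq τ hτ)) _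
      · simp
    rw [lintegral_congr_ae hae]
    simp [μ]
  simp only [hσ, Finset.sum_const, Finset.card_univ, Fintype.card_perm, Fintype.card_fin,
    nsmul_eq_mul] at hsum
  rw [mul_comm] at hsum
  exact ENNReal.eq_inv_of_mul_eq_one_left hsum

theorem seqLaw_cylinderSet {k : ℕ} {g : ℕ → ℕ} (c : ℕ → Bool) (hg : ∀ i < k, g i ≤ i) :
    seqLaw.real (cylinderSet k g c) = ((k.factorial : ℝ) * 2 ^ k)⁻¹ := by
  have h1 := (measurePreserving_window 0 k)
  have h2 := measurePreserving_arrowProdEquivProdArrow ℝ Bool (Fin k) (fun _ => unitLaw)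
    fun _ => colorLaw
  have h3 := h2.comp h1
  set R : Set (Fin k → ℝ) := {y | ∀ i < k, rank (extendHeights c y) i i = g i} with hR
  have hRm : MeasurableSet R := by
    have : R = ⋂ i, ⋂ _ : i < k, {y | rank (extendHeights c y) i i = g i} := by
      ext y
      simp [hR]
    rw [this]
    exact MeasurableSet.iInter fun i => MeasurableSet.iInter fun _ =>
      ((measurable_rank i i).comp (measurable_extendHeights c)) (measurableSet_singleton (g i))
  have hE : cylinderSet k g c = ((MeasurableEquiv.arrowProdEquivProdArrow ℝ Bool (Fin k)) ∘
      fun (w : ℕ → ℝ × Bool) (i : Fin k) => w (0 + i)) ⁻¹'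
        (R ×ˢ Set.univ.pi fun i : Fin k => {c i}) := by
    ext w
    have hrank : ∀ i < k, rank (extendHeights c fun j : Fin k => (w (0 + j)).1) i i = rank w i i := by
      intro i hi
      refine rank_congr (fun l hl => ?_) ?_
      · simp [extendHeights, hl.trans hi]
      · simp [extendHeights, hi]
    have hfst : ((MeasurableEquiv.arrowProdEquivProdArrow ℝ Bool (Fin k))
      fun i : Fin k => w (0 + i)) =
        (fun i : Fin k => (w (0 + i)).1, fun i : Fin k => (w (0 + i)).2) := rfl
    simp only [Set.mem_preimage, Function.comp_apply, hfst, Set.mem_prod, Set.mem_univ_pi,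
      Set.mem_singleton_iff]
    constructor
    · intro h
      exact ⟨fun i hi => (hrank i hi).trans (h i hi).1, fun i => by simpa using (h i i.2).2⟩
    · rintro ⟨ha, hb⟩ i hi
      exact ⟨(hrank i hi).symm.trans (ha i hi), by simpa using hb ⟨i, hi⟩⟩
  have hval : seqLaw (cylinderSet k g c) = (k.factorial : ENNReal)⁻¹ * (2⁻¹) ^ k := by
    rw [hE, h3.measure_preimage (hRm.prod (MeasurableSet.univ_pi fun i =>
      measurableSet_singleton _)).nullMeasurableSet, Measure.prod_prod, unitLaw_pi_rank c hg,
      Measure.pi_pi]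
    simp [colorLaw_singleton]
  rw [measureReal_def, hval]
  simp [ENNReal.toReal_mul, mul_comm]

/-! ### The linear lower bound for the mean. -/

/-- Extend a family of coordinates by a constant. -/
noncomputable def extendCoords {S : Finset ℕ} (u : S → ℝ × Bool) (i : ℕ) : ℝ × Bool :=
  if h : i ∈ S then u ⟨i, h⟩ else (0, true)

theorem measurable_extendCoords (S : Finset ℕ) :
    Measurable (extendCoords : (S → ℝ × Bool) → ℕ → ℝ × Bool) := by
  refine measurable_pi_iff.2 fun i => ?_
  by_cases h : i ∈ S
  · simpa [extendCoords, h] using measurable_pi_apply _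
  · simp [extendCoords, h]

/-- The event depends on the coordinates below `k` and the window on those from `k` on, so they are
independent: this is the fresh start after stopping. -/
theorem setIntegral_windowMax_cylinderSet (k n : ℕ) (g : ℕ → ℕ) (c : ℕ → Bool) :
    ∫ w in cylinderSet k g c, (windowMax w k n : ℝ) ∂seqLaw =
      seqLaw.real (cylinderSet k g c) * gridMean n := by
  have hE := measurableSet_cylinderSet k g c
  let φ : (Finset.range k → ℝ × Bool) → ℝ := fun u =>
    (cylinderSet k g c).indicator 1 (extendCoords u)
  let ψ : (Finset.Ico k (k + n) → ℝ × Bool) → ℝ := fun u => windowMax (extendCoords u) k n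
  have hφm : Measurable φ := (measurable_one.indicator hE).comp (measurable_extendCoords _)
  have hψm : Measurable ψ :=
    ((measurable_windowMax k n).comp (measurable_extendCoords _)).natCast_real
  have hind := iIndepFun_eval_seqLaw.indepFun_finset (Finset.range k) (Finset.Ico k (k + n))
    (by
      rw [Finset.disjoint_left]
      intro i h1 h2
      simp only [Finset.mem_range, Finset.mem_Ico] at h1 h2
      omega) fun i => measurable_pi_apply i
  have hind' := hind.comp hφm hψm
  have hφ : (φ ∘ fun (w : ℕ → ℝ × Bool) (i : Finset.range k) => w i) =
      (cylinderSet k g c).indicator 1 := by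
    funext w
    have hmem : extendCoords (fun i : Finset.range k => w i) ∈ cylinderSet k g c ↔
        w ∈ cylinderSet k g c :=
      mem_cylinderSet_congr fun i hi => by simp [extendCoords, hi]
    by_cases h : w ∈ cylinderSet k g c
    · simp only [φ, Function.comp_apply]
      rw [Set.indicator_of_mem (hmem.2 h), Set.indicator_of_mem h]
      rfl
    · simp only [φ, Function.comp_apply]
      rw [Set.indicator_of_notMem (mt hmem.1 h), Set.indicator_of_notMem h]
  have hψ : (ψ ∘ fun (w : ℕ → ℝ × Bool) (i : Finset.Ico k (k + n)) => w i) =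
      fun w => (windowMax w k n : ℝ) := by
    funext w
    simp only [ψ, Function.comp_apply, windowMax]
    congr 2
    funext i
    have : extendCoords (fun i : Finset.Ico k (k + n) => w i) (k + i) = w (k + i) := by
      simp [extendCoords]
    rw [graphPoint, graphPoint, this]
  have hmul := hind'.integral_fun_mul_eq_mul_integral
    (hφm.comp (by fun_prop)).aestronglyMeasurable (hψm.comp (by fun_prop)).aestronglyMeasurable
  rw [hφ, hψ, integral_indicator_one hE, integral_windowMax] at hmul
  rw [← hmul, ← integral_indicator hE]
  refine integral_congr_ae (Eventually.of_forall fun w => ?_)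
  by_cases h : w ∈ cylinderSet k g c <;> simp [h]

theorem setIntegral_cylinderSet_succ (k : ℕ) (g : ℕ → ℕ) (c : ℕ → Bool)
    {f : (ℕ → ℝ × Bool) → ℝ} (hf : Integrable f seqLaw) :
    ∫ w in cylinderSet k g c, f w ∂seqLaw = ∑ a ∈ Finset.range (k + 1),
      ((∫ w in cylinderSet (k + 1) (Function.update g k a) (Function.update c k true), f w ∂seqLaw) +
      ∫ w in cylinderSet (k + 1) (Function.update g k a) (Function.update c k false), f w ∂seqLaw) := by
  have hmem : ∀ a b w, w ∈ cylinderSet (k + 1) (Function.update g k a) (Function.update c k b) ↔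
      w ∈ cylinderSet k g c ∧ rank w k k = a ∧ (w k).2 = b := by
    intro a b w
    constructor
    · intro h
      refine ⟨fun i hi => ?_, ?_⟩
      · simpa [hi.ne] using h i (by omega)
      · simpa using h k (by omega)
    · rintro ⟨h, h'⟩ i hi
      rcases Nat.lt_succ_iff_lt_or_eq.1 hi with hi | rfl
      · simpa [hi.ne] using h i hi
      · simpa using h'
  have hU : cylinderSet k g c = ⋃ p ∈ Finset.range (k + 1) ×ˢ (Finset.univ : Finset Bool),
      cylinderSet (k + 1) (Function.update g k p.1) (Function.update c k p.2) := by
    ext w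
    simp only [Set.mem_iUnion, hmem, exists_prop, Finset.mem_product, Finset.mem_range,
      Finset.mem_univ, and_true, Prod.exists]
    constructor
    · intro h
      exact ⟨_, _, Nat.lt_succ_of_le (rank_le w k k), h, rfl, rfl⟩
    · rintro ⟨_, _, _, h, -⟩
      exact h
  conv_lhs => rw [hU]
  rw [integral_biUnion_finset _ (fun p _ => measurableSet_cylinderSet _ _ _) ?_
    fun p _ => hf.integrableOn, Finset.sum_product]
  · simp only [Fintype.sum_bool]
  · intro p _ q _ hne
    rw [Function.onFun, Set.disjoint_left]
    intro w hp hq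
    rw [hmem] at hp hq
    exact hne (Prod.ext (hp.2.1.symm.trans hq.2.1) (hp.2.2.symm.trans hq.2.2))

theorem units_pos (d k : ℕ) : 0 < units d k := by
  induction d generalizing k with
  | zero => exact Nat.one_pos
  | succ d ih => exact Nat.mul_pos (by omega) (ih _)

/-- Induction on the certificate. A stop uses the fresh window of `n - k` points and the bound `hn`;
a step splits the cylinder into 2(k + 1) equally likely ones. The loss 7 is not accumulated, as each
branch stops once and then invokes `hn`. -/
theorem setIntegral_windowMax_ge {n : ℕ} {d k : ℕ} {s : List Pending} {x : ℕ}
    (hx : Achieves d k s x) (hn : ∀ n' < n, 0.831 * (n' : ℝ) - 7 ≤ gridMean n') (hk : 1 ≤ k)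
    (hkd : k + d ≤ n) {g : ℕ → ℕ} (hg : ∀ i < k, g i ≤ i) (c : ℕ → Bool) (m : ℕ)
    (hI : ∀ w ∈ cylinderSet k g c, (Function.Injective fun i => (w i).1) → Invariant w k s m) :
    ((k.factorial : ℝ) * 2 ^ k)⁻¹ *
      (2 * m + (x : ℝ) / (1000 * units d k) + 0.831 * ((n : ℝ) - k) - 7) ≤
      ∫ w in cylinderSet k g c, (windowMax w 0 n : ℝ) ∂seqLaw := by
  have hrest : ∀ {k : ℕ} {s : List Pending} {g : ℕ → ℕ} (c : ℕ → Bool) (m : ℕ), 1 ≤ k → k ≤ n →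
      (∀ i < k, g i ≤ i) → (∀ w ∈ cylinderSet k g c, (Function.Injective fun i => (w i).1) →
        Invariant w k s m) → ((k.factorial : ℝ) * 2 ^ k)⁻¹ *
      (2 * m + 0.831 * ((n : ℝ) - k) - 7) ≤
      ∫ w in cylinderSet k g c, (windowMax w 0 n : ℝ) ∂seqLaw := by
    intro k s g c m hk hkn hg hI
    have hE := measurableSet_cylinderSet k g c
    have hq := seqLaw_cylinderSet c hg
    have h1 : ∫ w in cylinderSet k g c, ((2 * m : ℝ) + windowMax w k (n - k)) ∂seqLaw ≤
        ∫ w in cylinderSet k g c, (windowMax w 0 n : ℝ) ∂seqLaw := by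
      refine setIntegral_mono_on_ae ((integrable_const _).add
        (integrable_windowMax k (n - k))).integrableOn (integrable_windowMax 0 n).integrableOn hE ?_
      filter_upwards [ae_injective_seqLaw] with w hw hwE
      have := (hI w hwE hw).card_add_le (n - k)
      rw [Nat.add_sub_cancel' hkn] at this
      exact_mod_cast this
    rw [integral_add (integrable_const _) (integrable_windowMax k (n - k)).integrableOn,
      setIntegral_windowMax_cylinderSet, setIntegral_const, hq, smul_eq_mul, ← mul_add] at h1
    refine le_trans (mul_le_mul_of_nonneg_left ?_ (by positivity)) h1
    have := hn (n - k) (by omega)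
    rw [Nat.cast_sub hkn] at this
    linarith
  induction hx generalizing g c m with
  | rest d k s =>
    have := hrest c m hk (by omega) hg hI
    simpa using this
  | step d k s r x s' hmove hnext ih =>
    -- If the truncated subtraction is not exact, the claimed excess is 0 and stopping at once
    -- proves the bound.
    by_cases hle : 831 * units (d + 1) k ≤ ∑ a ∈ Finset.range (k + 1),
        ((2000 * units d (k + 1) * r a true + x a true) +
          (2000 * units d (k + 1) * r a false + x a false))
    · rw [setIntegral_cylinderSet_succ k g c (integrable_windowMax 0 n)]
      have hu : (0 : ℝ) < units d (k + 1) := by exact_mod_cast units_pos d (k + 1)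
      have hab : ∀ a ∈ Finset.range (k + 1), ∀ b,
          (((k + 1).factorial : ℝ) * 2 ^ (k + 1))⁻¹ * (2 * ((m : ℝ) + r a b) +
            (x a b : ℝ) / (1000 * units d (k + 1)) + 0.831 * ((n : ℝ) - (k + 1)) - 7) ≤
          ∫ w in cylinderSet (k + 1) (Function.update g k a) (Function.update c k b),
            (windowMax w 0 n : ℝ) ∂seqLaw := by
        intro a ha b
        have hg' : ∀ i < k + 1, Function.update g k a i ≤ i := by
          intro i hi
          rcases Nat.lt_succ_iff_lt_or_eq.1 hi with hi | rfl
          · simpa [hi.ne] using hg i hi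
          · simpa using Nat.lt_succ_iff.1 (Finset.mem_range.1 ha)
        have := ih a b (by omega) (by omega) hg' (Function.update c k b) (m + r a b) ?_
        · push_cast at this
          exact this
        · intro w hwE hw
          have hwk := hwE k (Nat.lt_succ_self k)
          rw [Function.update_self, Function.update_self] at hwk
          refine hmove a b w hw m (hI w (fun i hi => ?_) hw) hwk.1 hwk.2
          simpa [hi.ne] using hwE i (by omega)
      refine le_trans (le_of_eq ?_) (Finset.sum_le_sum fun a ha =>
        add_le_add (hab a ha true) (hab a ha false))
      rw [Nat.cast_sub hle]
      have hterm : ∀ a b, (2 * ((m : ℝ) + r a b) + (x a b : ℝ) / (1000 * units d (k + 1)) +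
          0.831 * ((n : ℝ) - (k + 1)) - 7) = (2 * m + 0.831 * ((n : ℝ) - (k + 1)) - 7) +
          (1000 * (units d (k + 1) : ℝ))⁻¹ * ((2000 * units d (k + 1) * r a b + x a b : ℕ) : ℝ) := by
        intro a b
        push_cast
        field_simp
        ring
      simp only [hterm, ← mul_add]
      rw [← Finset.mul_sum]
      have hsum : ∀ F : ℕ → Bool → ℝ, ∀ A B : ℝ, ∑ a ∈ Finset.range (k + 1),
          ((A + B * F a true) + (A + B * F a false)) =
          2 * (k + 1) * A + B * ∑ a ∈ Finset.range (k + 1), (F a true + F a false) := by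
        intro F A B
        rw [Finset.mul_sum, ← sub_eq_iff_eq_add']
        have : (2 * ((k : ℝ) + 1) * A) = ∑ a ∈ Finset.range (k + 1), (2 * A) := by
          simp
          ring
        rw [this, ← Finset.sum_sub_distrib]
        exact Finset.sum_congr rfl fun a _ => by ring
      rw [hsum (fun a b => ((2000 * units d (k + 1) * r a b + x a b : ℕ) : ℝ))]
      have hS : ((∑ a ∈ Finset.range (k + 1), ((2000 * units d (k + 1) * r a true + x a true) +
          (2000 * units d (k + 1) * r a false + x a false)) : ℕ) : ℝ) =
          ∑ a ∈ Finset.range (k + 1), (((2000 * units d (k + 1) * r a true + x a true : ℕ) : ℝ) +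
          ((2000 * units d (k + 1) * r a false + x a false : ℕ) : ℝ)) := by
        rw [Nat.cast_sum]
        exact Finset.sum_congr rfl fun a _ => Nat.cast_add _ _
      rw [hS]
      generalize ∑ a ∈ Finset.range (k + 1),
        (((2000 * units d (k + 1) * r a true + x a true : ℕ) : ℝ) +
          ((2000 * units d (k + 1) * r a false + x a false : ℕ) : ℝ)) = S
      rw [Nat.factorial_succ, show units (d + 1) k = 2 * (k + 1) * units d (k + 1) from rfl]
      have hfac : (0 : ℝ) < k.factorial := by exact_mod_cast k.factorial_pos
      push_cast
      field_simp
      ring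
    · rw [Nat.sub_eq_zero_of_le (by omega)]
      have := hrest c m hk (by omega) hg hI
      simpa using this

/-- Strong induction: a sweep with horizon eight consumes at least one point and has nonnegative
expected excess. For fewer than eight points the left side is negative, which is why 7 can be
subtracted. -/
theorem gridMean_ge (n : ℕ) : 0.831 * (n : ℝ) - 7 ≤ gridMean n := by
  induction n using Nat.strong_induction_on with
  | _ n ih =>
    rcases lt_or_ge n 8 with hn | hn
    · have h1 : (n : ℝ) ≤ 7 := by exact_mod_cast Nat.lt_succ_iff.1 hn
      linarith [gridMean_nonneg n]
    · have hb : ∀ b : Bool, 2⁻¹ * (((value 6 1 [⟨0, b, 0, 1⟩] : ℕ) : ℝ) / (1000 * units 7 1) +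
          0.831 * ((n : ℝ) - 1) - 7) ≤ ∫ w in cylinderSet (0 + 1)
          (Function.update (fun _ => 0) 0 0) (Function.update (fun _ => true) 0 b),
            (windowMax w 0 n : ℝ) ∂seqLaw := by
        intro b
        have := setIntegral_windowMax_ge (achieves_value 6 1 [⟨0, b, 0, 1⟩]) ih le_rfl (by omega)
          (g := Function.update (fun _ => 0) 0 0) (by simp) (Function.update (fun _ => true) 0 b) 0
          (fun w hwE hw => ?_)
        · generalize value 6 1 [⟨0, b, 0, 1⟩] = v at this ⊢
          generalize units 7 1 = u at this ⊢
          simpa using this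
        · refine isMove_first b w hw 0 (invariant_zero w) ?_ ?_
          · simp [rank]
          · simpa using (hwE 0 Nat.zero_lt_one).2
      have h0 : ∫ w in cylinderSet 0 (fun _ => 0) (fun _ => true), (windowMax w 0 n : ℝ) ∂seqLaw =
          gridMean n := by
        rw [show cylinderSet 0 (fun _ => 0) (fun _ => true) = Set.univ by simp [cylinderSet],
          setIntegral_univ, integral_windowMax]
      rw [setIntegral_cylinderSet_succ _ _ _ (integrable_windowMax 0 n)] at h0
      simp only [zero_add, Finset.range_one, Finset.sum_singleton] at h0
      rw [← h0]
      refine le_trans ?_ (add_le_add (hb true) (hb false))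
      have hv : (831 * (units 8 0 : ℕ) : ℝ) ≤
          (value 6 1 [⟨0, true, 0, 1⟩] : ℕ) + (value 6 1 [⟨0, false, 0, 1⟩] : ℕ) := by
        exact_mod_cast le_value_first
      have hu : units 8 0 = 2 * units 7 1 := by rw [units]
      have hu' : (0 : ℝ) < (units 7 1 : ℕ) := by exact_mod_cast units_pos 7 1
      rw [hu] at hv
      push_cast at hv
      generalize ((value 6 1 [⟨0, true, 0, 1⟩] : ℕ) : ℝ) = A at *
      generalize ((value 6 1 [⟨0, false, 0, 1⟩] : ℕ) : ℝ) = B at *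
      generalize ((units 7 1 : ℕ) : ℝ) = U at *
      have hAB : 2 * 0.831 ≤ A / (1000 * U) + B / (1000 * U) := by
        rw [← add_div, le_div_iff₀ (by positivity)]
        linarith
      linarith


/-! ### Concentration by bounded differences, and Borel–Cantelli. -/

theorem integrable_of_abs_le {α : Type*} [MeasurableSpace α] {μ : Measure α} [IsFiniteMeasure μ]
    {f : α → ℝ} (hf : Measurable f) {B : ℝ} (h : ∀ a, |f a| ≤ B) : Integrable f μ :=
  Integrable.of_bound hf.aestronglyMeasurable B (Eventually.of_forall h)

theorem integrable_exp_of_abs_le {α : Type*} [MeasurableSpace α] {μ : Measure α}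
    [IsFiniteMeasure μ] {f : α → ℝ} (hf : Measurable f) {B : ℝ} (h : ∀ a, |f a| ≤ B) (t : ℝ) :
    Integrable (fun a => Real.exp (t * f a)) μ := by
  refine integrable_of_abs_le (Real.measurable_exp.comp (hf.const_mul t)) (B := Real.exp (|t| * B))
    fun a => ?_
  rw [abs_of_pos (Real.exp_pos _), Real.exp_le_exp]
  calc t * f a ≤ |t * f a| := le_abs_self _
    _ = |t| * |f a| := abs_mul _ _
    _ ≤ |t| * B := mul_le_mul_of_nonneg_left (h a) (abs_nonneg t)

theorem abs_integral_le_of_abs_le {α : Type*} [MeasurableSpace α] {μ : Measure α}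
    [IsProbabilityMeasure μ] {f : α → ℝ} {B : ℝ} (h : ∀ a, |f a| ≤ B) : |∫ a, f a ∂μ| ≤ B := by
  simpa using norm_integral_le_of_norm_le_const (μ := μ) (f := f) (C := B) (Eventually.of_forall h)

/-- The exponential moments in the bounded differences inequality. -/
theorem integral_exp_sub_integral_le {α : Type*} [MeasurableSpace α] (ν : Measure α)
    [IsProbabilityMeasure ν] {B D : ℝ} (t : ℝ) {n : ℕ} {f : (Fin n → α) → ℝ} (hf : Measurable f)
    (hB : ∀ z, |f z| ≤ B)
    (hD : ∀ z z' k, (∀ i, i ≠ k → z' i = z i) → |f z - f z'| ≤ D) :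
    ∫ z, Real.exp (t * (f z - ∫ z', f z' ∂(Measure.pi fun _ => ν))) ∂(Measure.pi fun _ => ν) ≤
      Real.exp (n * D ^ 2 * t ^ 2 / 2) := by
  induction n with
  | zero =>
    have hc : ∀ z, f z = f default := fun z => by rw [Subsingleton.elim z default]
    simp only [hc, integral_const, probReal_univ, smul_eq_mul, one_mul, sub_self, mul_zero]
    simp
  | succ n ih =>
    set μ := Measure.pi fun _ : Fin n => ν
    have hp : MeasurePreserving (MeasurableEquiv.piFinSuccAbove (fun _ : Fin (n + 1) => α) 0).symm
        (ν.prod μ) (Measure.pi fun _ => ν) :=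
      (measurePreserving_piFinSuccAbove (fun _ : Fin (n + 1) => ν) 0).symm _
    set e := (MeasurableEquiv.piFinSuccAbove (fun _ : Fin (n + 1) => α) 0).symm
    have he0 : ∀ a z, e (a, z) 0 = a := fun a z => Fin.insertNth_apply_same (α := fun _ => α) 0 a z
    have hes : ∀ a z i, e (a, z) (Fin.succ i) = z i := fun a z i => by
      have := Fin.insertNth_apply_succAbove (α := fun _ => α) 0 a z i
      rwa [Fin.zero_succAbove] at this
    have hfe : Measurable fun p => f (e p) := hf.comp e.measurable
    have hfa : ∀ a, Measurable fun z => f (e (a, z)) := fun a =>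
      hfe.comp measurable_prodMk_left
    -- Averaging over all coordinates but the first gives the first martingale difference `F a - M`;
    -- the others are handled by induction for fixed `a`.
    set F : α → ℝ := fun a => ∫ z, f (e (a, z)) ∂μ with hF
    have hFm : Measurable F := (hfe.stronglyMeasurable.integral_prod_right').measurable
    have hFB : ∀ a, |F a| ≤ B := fun a => abs_integral_le_of_abs_le fun z => hB _
    have hm : ∫ z', f z' ∂(Measure.pi fun _ => ν) = ∫ a, F a ∂ν := by
      rw [← hp.integral_comp', integral_prod _ (integrable_of_abs_le hfe fun p => hB _)]
    rw [hm]
    set M := ∫ a, F a ∂ν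
    have hMB : |M| ≤ B := abs_integral_le_of_abs_le hFB
    have hFD : ∀ a a', |F a - F a'| ≤ D := by
      intro a a'
      rw [hF]
      simp only
      rw [← integral_sub (integrable_of_abs_le (hfa a) fun z => hB _)
        (integrable_of_abs_le (hfa a') fun z => hB _)]
      refine abs_integral_le_of_abs_le fun z => hD _ _ 0 fun i hi => ?_
      obtain ⟨j, rfl⟩ := Fin.exists_succ_eq.2 hi
      rw [hes, hes]
    have hsub : HasSubgaussianMGF (fun a => F a - ∫ a, F a ∂ν) (‖D‖₊ ^ 2) ν := by
      have hne : Nonempty α := ν.nonempty_of_neZero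
      obtain ⟨a₀⟩ := hne
      -- Hoeffding's lemma on an interval of length `2 * D` around an arbitrary value of `F` gives
      -- the variance proxy `D ^ 2`; the optimal constant is not needed.
      have := hasSubgaussianMGF_of_mem_Icc (μ := ν) (X := F) (a := F a₀ - D) (b := F a₀ + D)
        hFm.aemeasurable (Eventually.of_forall fun a => by
          have := abs_le.1 (hFD a a₀)
          constructor <;> linarith)
      convert this using 2
      rw [show F a₀ + D - (F a₀ - D) = 2 * D by ring, nnnorm_mul]
      simp
    have hFexp : ∫ a, Real.exp (t * (F a - M)) ∂ν ≤ Real.exp (D ^ 2 * t ^ 2 / 2) := by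
      have := hsub.mgf_le t
      simpa [mgf] using this
    have hin : ∀ a, ∫ z, Real.exp (t * (f (e (a, z)) - F a)) ∂μ ≤
        Real.exp (n * D ^ 2 * t ^ 2 / 2) := by
      intro a
      refine ih (f := fun z => f (e (a, z))) (hfa a) (fun z => hB _) fun z z' k h => ?_
      refine hD _ _ k.succ fun i hi => ?_
      refine Fin.cases ?_ (fun j hj => ?_) i hi
      · intro _
        rw [he0, he0]
      · rw [hes, hes]
        exact h j fun hjk => hj (by rw [hjk])
    have hexp : Integrable (fun p => Real.exp (t * (f (e p) - M))) (ν.prod μ) :=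
      integrable_exp_of_abs_le (hfe.sub_const M) (B := B + B)
        (fun p => (abs_sub _ _).trans (add_le_add (hB _) hMB)) t
    rw [← hp.integral_comp', integral_prod _ hexp]
    calc ∫ a, ∫ z, Real.exp (t * (f (e (a, z)) - M)) ∂μ ∂ν
        = ∫ a, (∫ z, Real.exp (t * (f (e (a, z)) - F a)) ∂μ) * Real.exp (t * (F a - M)) ∂ν := by
          refine integral_congr_ae (Eventually.of_forall fun a => ?_)
          simp only
          rw [← integral_mul_const]
          refine integral_congr_ae (Eventually.of_forall fun z => ?_)
          simp only
          rw [← Real.exp_add]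
          congr 1
          ring
      _ ≤ ∫ a, Real.exp (n * D ^ 2 * t ^ 2 / 2) * Real.exp (t * (F a - M)) ∂ν := by
          refine integral_mono_of_nonneg (Eventually.of_forall fun a => ?_) ?_
            (Eventually.of_forall fun a => ?_)
          · exact mul_nonneg (integral_nonneg fun _ => (Real.exp_pos _).le) (Real.exp_pos _).le
          · exact (integrable_exp_of_abs_le (hFm.sub_const M) (B := B + B)
              (fun p => (abs_sub _ _).trans (add_le_add (hFB _) hMB)) t).const_mul _
          · exact mul_le_mul_of_nonneg_right (hin a) (Real.exp_pos _).le
      _ = Real.exp (n * D ^ 2 * t ^ 2 / 2) * ∫ a, Real.exp (t * (F a - M)) ∂ν :=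
          integral_const_mul _ _
      _ ≤ Real.exp (n * D ^ 2 * t ^ 2 / 2) * Real.exp (D ^ 2 * t ^ 2 / 2) :=
          mul_le_mul_of_nonneg_left hFexp (Real.exp_pos _).le
      _ = _ := by
          rw [← Real.exp_add]
          congr 1
          push_cast
          ring

/-- The proxy is n · 4², as one point influences the maximum by at most 4. -/
theorem hasSubgaussianMGF_maxCovered (n : ℕ) :
    HasSubgaussianMGF (fun z => (maxCovered z : ℝ) - expectedMax n) (n * 16) (configLaw n) := by
  have hB : ∀ z : Fin n → ColoredPoint, |(maxCovered z : ℝ)| ≤ n := fun z => by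
    rw [abs_of_nonneg (Nat.cast_nonneg _)]
    exact_mod_cast maxCovered_le z
  have hm := (measurable_maxCovered n).natCast_real
  refine ⟨fun t => ?_, fun t => ?_⟩
  · exact integrable_exp_of_abs_le (hm.sub_const _) (B := n + n) (fun z => (abs_sub _ _).trans
      (add_le_add (hB z) (abs_integral_le_of_abs_le hB))) t
  · have := integral_exp_sub_integral_le coloredPointLaw (D := 4) t hm hB fun z z' k h => by
      have h1 := maxCovered_le_update k h
      have h2 := maxCovered_le_update (z := z') (z' := z) k fun i hi => (h i hi).symm
      have h1' : (maxCovered z : ℝ) ≤ maxCovered z' + 4 := by exact_mod_cast h1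
      have h2' : (maxCovered z' : ℝ) ≤ maxCovered z + 4 := by exact_mod_cast h2
      rw [abs_le]
      constructor <;> linarith
    refine this.trans (le_of_eq ?_)
    push_cast
    norm_num

theorem configLaw_abs_sub_ge_le (n : ℕ) {ε : ℝ} (hε : 0 < ε) :
    configLaw n {z | ε * n ≤ |(maxCovered z : ℝ) - expectedMax n|} ≤
      ENNReal.ofReal (2 * Real.exp (-(ε ^ 2 / 32)) ^ n) := by
  have hs := hasSubgaussianMGF_maxCovered n
  have h1 := hs.measure_ge_le (ε := ε * n) (by positivity)
  have h2 := hs.neg.measure_ge_le (ε := ε * n) (by positivity)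
  have hexp : Real.exp (-(ε * n) ^ 2 / (2 * ((n * 16 : NNReal) : ℝ))) =
      Real.exp (-(ε ^ 2 / 32)) ^ n := by
    rw [← Real.exp_nat_mul]
    congr 1
    rcases Nat.eq_zero_or_pos n with rfl | hn
    · simp
    · have : (0 : ℝ) < n := by exact_mod_cast hn
      push_cast
      field_simp
      ring
  rw [hexp] at h1 h2
  rw [← ofReal_measureReal]
  refine ENNReal.ofReal_le_ofReal ?_
  have hsub : {z | ε * n ≤ |(maxCovered z : ℝ) - expectedMax n|} ⊆
      {z : Fin n → ColoredPoint | ε * n ≤ (maxCovered z : ℝ) - expectedMax n} ∪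
      {z | ε * n ≤ (-fun z => (maxCovered z : ℝ) - expectedMax n) z} := by
    intro z hz
    have hz' : ε * n ≤ |(maxCovered z : ℝ) - expectedMax n| := hz
    exact le_abs.1 hz'
  calc _ ≤ _ := measureReal_mono hsub
    _ ≤ _ := measureReal_union_le _ _
    _ ≤ _ := add_le_add h1 h2
    _ = _ := by ring

/-- The deviation probabilities are bounded by a geometric series for each tolerance 1/(k + 1). The
convergence half of Borel–Cantelli needs no independence, so only the marginal laws matter. -/
theorem ae_tendsto_maxCovered_sub {Ω : Type*} [MeasurableSpace Ω] (P : Measure Ω)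
    [IsProbabilityMeasure P] (S : (n : ℕ) → Ω → Fin n → ColoredPoint)
    (hS : ∀ n : ℕ, HasLaw (S n) (configLaw n) P) :
    ∀ᵐ ω ∂P, Tendsto (fun n : ℕ => (maxCovered (S n ω) : ℝ) / n - expectedMax n / n) atTop
      (𝓝 0) := by
  have hk : ∀ k : ℕ, ∀ᵐ ω ∂P, ∀ᶠ n : ℕ in atTop,
      |(maxCovered (S n ω) : ℝ) - expectedMax n| < (1 / ((k : ℝ) + 1)) * n := by
    intro k
    have hε : (0 : ℝ) < 1 / ((k : ℝ) + 1) := by positivity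
    set ε := 1 / ((k : ℝ) + 1)
    have hle : ∀ n, P {ω | ε * n ≤ |(maxCovered (S n ω) : ℝ) - expectedMax n|} ≤
        ENNReal.ofReal (2 * Real.exp (-(ε ^ 2 / 32)) ^ n) := by
      intro n
      rw [(hS n).measure_eq (p := fun z => ε * n ≤ |(maxCovered z : ℝ) - expectedMax n|)]
      · exact configLaw_abs_sub_ge_le n hε
      · have := (measurable_maxCovered n).natCast_real
        exact measurableSet_le measurable_const (this.sub_const _).norm
    have hsum : ∑' n, P {ω | ε * n ≤ |(maxCovered (S n ω) : ℝ) - expectedMax n|} ≠ ⊤ := by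
      refine ne_top_of_le_ne_top ?_ (ENNReal.tsum_le_tsum hle)
      refine Summable.tsum_ofReal_ne_top (Summable.mul_left _ ?_)
      refine summable_geometric_of_lt_one (Real.exp_pos _).le ?_
      rw [Real.exp_lt_one_iff]
      have : 0 < ε ^ 2 := by positivity
      linarith
    filter_upwards [ae_eventually_notMem hsum] with ω hω
    filter_upwards [hω] with n hn
    simpa using hn
  filter_upwards [ae_all_iff.2 hk] with ω hω
  rw [Metric.tendsto_atTop']
  intro δ hδ
  obtain ⟨k, hk⟩ := exists_nat_one_div_lt hδ
  obtain ⟨N, hN⟩ := eventually_atTop.1 (hω k)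
  refine ⟨N, fun n hn => ?_⟩
  have h := hN n hn.le
  have hn0 : (0 : ℝ) < n := by exact_mod_cast (Nat.zero_le N).trans_lt hn
  rw [dist_zero_right, ← sub_div, Real.norm_eq_abs, abs_div, abs_of_pos hn0, div_lt_iff₀ hn0]
  exact h.trans (mul_lt_mul_of_pos_right hk hn0)

/-! ### Fekete's lemma and the conclusion. -/

theorem subadditive_neg_gridMean : Subadditive fun n => -gridMean n := fun m n => by
  linarith [gridMean_add_le m n]

theorem exists_isLUB_tendsto_gridMean : ∃ L : ℝ, 0.831 ≤ L ∧
    IsLUB {x : ℝ | ∃ n : ℕ, 1 ≤ n ∧ x = gridMean n / n} L ∧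
    Tendsto (fun n : ℕ => gridMean n / n) atTop (𝓝 L) := by
  have hle : ∀ n : ℕ, gridMean n / n ≤ 1 := fun n =>
    div_le_one_of_le₀ (gridMean_le n) (Nat.cast_nonneg n)
  have hbdd : BddBelow (Set.range fun n : ℕ => -gridMean n / n) := by
    refine ⟨-1, ?_⟩
    rintro _ ⟨n, rfl⟩
    simp only [neg_div]
    exact neg_le_neg (hle n)
  have hsub := subadditive_neg_gridMean
  have hlim : Tendsto (fun n : ℕ => gridMean n / n) atTop (𝓝 (-hsub.lim)) := by
    have := (hsub.tendsto_lim hbdd).neg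
    refine this.congr fun n => ?_
    rw [neg_div, neg_neg]
  refine ⟨-hsub.lim, ?_, ⟨?_, ?_⟩, hlim⟩
  · have hlow : Tendsto (fun n : ℕ => 0.831 - 7 / (n : ℝ)) atTop (𝓝 (0.831 - 0)) :=
      tendsto_const_nhds.sub (tendsto_const_div_atTop_nhds_zero_nat 7)
    rw [sub_zero] at hlow
    refine le_of_tendsto_of_tendsto hlow hlim ?_
    filter_upwards [eventually_gt_atTop 0] with n hn
    have hn0 : (0 : ℝ) < n := by exact_mod_cast hn
    rw [le_div_iff₀ hn0, sub_mul, div_mul_cancel₀ _ hn0.ne']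
    exact gridMean_ge n
  · rintro _ ⟨n, hn, rfl⟩
    have := hsub.lim_le_div hbdd (n := n) (by omega)
    rw [neg_div] at this
    linarith
  · intro u hu
    refine le_of_tendsto hlim ?_
    filter_upwards [eventually_ge_atTop 1] with n hn
    exact hu ⟨n, hn, rfl⟩

end RectMatching

/-- `S n` is the random coloured `n`-point set; nothing is assumed on the joint law of the sets
`S n` for different `n`. The first conjunct says that `M(n)` has a genuine expectation. -/
theorem theorem1 :
    (∀ n : ℕ, Integrable (fun z => (RectMatching.maxCovered z : ℝ)) (RectMatching.configLaw n)) ∧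
    ∃ β : ℝ, 0 < β ∧ ∃ L : ℝ, 0.83 + β ≤ L ∧
      IsLUB {x : ℝ | ∃ n : ℕ, 1 ≤ n ∧ x = RectMatching.expectedMax n / n} L ∧
      Tendsto (fun n : ℕ => RectMatching.expectedMax n / n) atTop (𝓝 L) ∧
      ∀ (Ω : Type*) [MeasurableSpace Ω] (P : Measure Ω) [IsProbabilityMeasure P]
        (S : (n : ℕ) → Ω → Fin n → RectMatching.ColoredPoint),
        (∀ n : ℕ, HasLaw (S n) (RectMatching.configLaw n) P) →
        ∀ᵐ ω ∂P, Tendsto (fun n : ℕ => (RectMatching.maxCovered (S n ω) : ℝ) / n) atTop (𝓝 L) := by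
  obtain ⟨L, hL, hLUB, hlim⟩ := RectMatching.exists_isLUB_tendsto_gridMean
  simp only [← RectMatching.expectedMax_eq_gridMean] at hLUB hlim
  -- The constant is 0.831 - 0.83.
  refine ⟨RectMatching.integrable_maxCovered, 0.001, by norm_num, L, by linarith, hLUB, hlim, ?_⟩
  intro Ω _ P _ S hS
  filter_upwards [RectMatching.ae_tendsto_maxCovered_sub P S hS] with ω hω
  simpa using hω.add hlim
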